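/- Let $\mathcal H$ be a separable complex Hilbert space, with inner product $\langle\cdot,\cdot\rangle$ linear in the first argument, $\mathcal L(\mathcal H)$ its bounded operators, $m,q\in\mathbb Z_+$, $U\subset\mathbb R^m$ open, and let $K:U\times U\to\mathcal L(\mathcal H)$ be a positive definite kernel, i.e. $\sum_{i,j}\langle K(x_i,x_j)v_j,v_i\rangle\ge 0$ for all finitely many distinct $x_i\in U$ and $v_i\in\mathcal H$. Let $\mathcal H_K$ be its reproducing kernel Hilbert space of functions $U\to\mathcal H$, so that $\langle K(\cdot,x)v,F\rangle_{\mathcal H_K}=\langle v,F(x)\rangle$. *Notation.* $C^q_0(U,\mathcal H)$ is the space of $F\in C^q(U,\mathcal H)$ such that $\partial^\alpha F$ vanishes at infinity on $U$ for all $|\alpha|\le q$. For a compact $\mathcal A\subset U$ with $\overline{\mathrm{Int}\,\mathcal A}=\mathcal A$, $C^q(\mathcal A,\mathcal H)$ is the space of continuous $F:\mathcal A\to\mathcal H$ that are $C^q$ on $\mathrm{Int}\,\mathcal A$ and whose derivatives $\partial^\alpha F$, $|\alpha|\le q$, extend continuously to $\mathcal A$ (the extension is again written $\partial^\alpha F$),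 with norm $\sum_{|\alpha|\le q}\sup_{\mathcal A}\|\partial^\alpha F\|$; $C^q_U(\mathcal A,\mathcal H)$ is the closure in it of $\{F|_{\mathcal A}: F\in C^q(U,\mathcal H)\}$. For $Z=U$ or $Z=\mathcal A$, $\mathfrak M^q(Z,\mathcal H)$ is the set of families $\eta=(\eta_\alpha)_{|\alpha|\le q}$ of $\mathcal H$-valued Radon measures of bounded variation on $Z$. $\int\langle F,d\eta_\alpha\rangle$ is the continuous extension of $\langle v,\eta_\alpha(B)\rangle$ for $F=v\chi_B$ to the functions $F$ that are Bochner integrable with respect to the variation $|\eta_\alpha|$. For $T:Z\to\mathcal L(\mathcal H)$, $\int T\,d\eta_\alpha\in\mathcal H$ is the weak-Bochner integral, defined by $\langle v,\int T\,d\eta_\alpha\rangle=\int\langle T(x)v,d\eta_\alpha(x)\rangle$ for all $v\in\mathcal H$; it exists if the functions $Tv$ are Bochner integrable with respect to $|\eta_\alpha|$ and the right side is continuous in $v$. $\partial_2^\beta K(x,y)$ denotes the derivative in $y$ in the weak operator sense, $\langle\partial_2^\beta K(x,y)v,u\rangle=\partial_y^\beta\langle K(x,y)v,u\rangle$, and $\partial_1^\alpha$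 the derivative in $x$ in the strong operator sense, $\partial_1^\alpha[\partial_2^\beta K(x,y)]v=\partial_x^\alpha(\partial_2^\beta K(x,y)v)$. $K$ is $C^q_0$-universal if $\mathcal H_K\subset C^q_0(U,\mathcal H)$ and for all $g\in C^q_0(U,\mathcal H)$, $\varepsilon>0$ there is $f\in\mathcal H_K$ with $\sup_{x\in U}\sum_{|\alpha|\le q}\|\partial^\alpha f(x)-\partial^\alpha g(x)\|<\varepsilon$; $K$ is $C^q$-universal if $\mathcal H_K\subset C^q(U,\mathcal H)$ and for all $g\in C^q(U,\mathcal H)$, compact $\mathcal A\subset U$ and $\varepsilon>0$ there is $f\in\mathcal H_K$ with the same inequality for the supremum over $\mathcal A$. **Theorem.** Suppose that $\mathcal H_K\subset C^q_0(U,\mathcal H)$ (resp. $\mathcal H_K\subset C^q(U,\mathcal H)$). Then the operators $\partial_1^\alpha[\partial_2^\beta K(x,y)]\in\mathcal L(\mathcal H)$, $|\alpha|,|\beta|\le q$, exist, with $x\mapsto\partial_2^\beta K(x,y)v$ in $C^q_0(U,\mathcal H)$ (resp. $C^q(U,\mathcal H)$) for all $y\in U$, $v\in\mathcal H$, and the following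 holds, where all the integrals exist and $Z=U$ (resp. $Z=\mathcal A$ is any compact subset of $U$ with $\overline{\mathrm{Int}\,\mathcal A}=\mathcal A$). (i) For every $\eta\in\mathfrak M^q(Z,\mathcal H)$ the function $$K_\eta(y)=\sum_{|\alpha|\le q}\int\partial_1^\alpha K(x,y)\,d\eta_\alpha(x),\qquad y\in U,$$ is an element of $\mathcal H_K$. (ii) For every $|\beta|\le q$ and $y\in U$, $\ \partial^\beta K_\eta(y)=\sum_{|\alpha|\le q}\int\partial_1^\alpha[\partial_2^\beta K(x,y)]\,d\eta_\alpha(x)$. (iii) $$\langle K_\eta,K_\eta\rangle_{\mathcal H_K}=\sum_{|\alpha|,|\beta|\le q}\int\Big\langle\int\partial_1^\alpha[\partial_2^\beta K(x,y)]\,d\eta_\alpha(x),d\eta_\beta(y)\Big\rangle,$$ and if $d\eta_\alpha=H_\alpha\,d\mu$ for all $|\alpha|\le q$, with a finite nonnegative measure $\mu$ on $Z$ and functions $H_\alpha:Z\to\mathcal H$ that are Bochner integrable with respect to $\mu$, then $$\langle K_\eta,K_\eta\rangle_{\mathcal H_K}=\sum_{|\alpha|,|\beta|\le q}\int\int\langle\partial_1^\alpha[\partial_2^\beta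 K(x,y)]H_\beta(y),H_\alpha(x)\rangle\,d\mu(x)\,d\mu(y).$$ (iv) $K$ is $C^q_0$-universal if and only if $\langle K_\eta,K_\eta\rangle_{\mathcal H_K}>0$ for all $\eta\in\mathfrak M^q(U,\mathcal H)$ for which the functional $F\mapsto\sum_{|\alpha|\le q}\int\langle\partial^\alpha F,d\eta_\alpha\rangle$ on $C^q_0(U,\mathcal H)$ is nonzero. (Resp. $K$ is $C^q$-universal if and only if $\langle K_\eta,K_\eta\rangle_{\mathcal H_K}>0$ for all compact $\mathcal A\subset U$ with $\overline{\mathrm{Int}\,\mathcal A}=\mathcal A$ and all $\eta\in\mathfrak M^q(\mathcal A,\mathcal H)$ for which the functional $F\mapsto\sum_{|\alpha|\le q}\int\langle\partial^\alpha F,d\eta_\alpha\rangle$ on $C^q_U(\mathcal A,\mathcal H)$ is nonzero.) -/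

import Mathlib

open MeasureTheory Filter Topology
open scoped ComplexOrder

noncomputable section

/-! ### Multi-indices, derivatives and spaces of differentiable functions -/

/-- The finite set of multi-indices `α ∈ ℕ^m` with `|α| ≤ q`. -/
def multiIndices (m q : ℕ) : Finset (Fin m → ℕ) :=
  (Fintype.piFinset fun _ : Fin m => Finset.range (q + 1)).filter fun α => ∑ i, α i ≤ q

theorem mem_multiIndices {m q : ℕ} {α : Fin m → ℕ} :
    α ∈ multiIndices m q ↔ ∑ i, α i ≤ q := by
  simp only [multiIndices, Finset.mem_filter, Fintype.mem_piFinset, Finset.mem_range,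
    and_iff_right_iff_imp]
  intro h i
  have := Finset.single_le_sum (f := α) (fun j _ => Nat.zero_le _) (Finset.mem_univ i)
  omega

/-- Multi-indices `α ∈ ℕ^m` with `|α| ≤ q`, as a (finite) type. -/
abbrev MultiIndex (m q : ℕ) : Type := ↥(multiIndices m q)

/-- The multi-index `0`. -/
def zeroIndex (m q : ℕ) : MultiIndex m q := ⟨0, mem_multiIndices.2 (by simp)⟩

section Derivatives

variable {m : ℕ} {V : Type*} [NormedAddCommGroup V] [NormedSpace ℝ V]

/-- The partial derivative `∂^{e_i} f`. -/
def partialDeriv (i : Fin m) (f : EuclideanSpace ℝ (Fin m) → V) :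
    EuclideanSpace ℝ (Fin m) → V :=
  fun x => lineDeriv ℝ f x (EuclideanSpace.single i (1 : ℝ))

/-- The iterated partial derivative `(∂^{e_1})^{α_1} ⋯ (∂^{e_m})^{α_m} f`. -/
def iterPartial (α : Fin m → ℕ) (f : EuclideanSpace ℝ (Fin m) → V) :
    EuclideanSpace ℝ (Fin m) → V :=
  (List.finRange m).foldr (fun i g => (partialDeriv i)^[α i] g) f

/-- Extension by zero of a function defined on a subset of `ℝ^m`. -/
def extendZero {S : Set (EuclideanSpace ℝ (Fin m))} (F : S → V) :
    EuclideanSpace ℝ (Fin m) → V :=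
  Function.extend Subtype.val F 0

/-- `∂^α F` for a function `F` on a set `U`. For `U` open, this depends only on the
values of `F` on `U`, and not on the way in which `F` is extended. -/
def dAlpha {U : Set (EuclideanSpace ℝ (Fin m))} (α : Fin m → ℕ) (F : U → V) : U → V :=
  fun x => iterPartial α (extendZero F) x

/-- `F ∈ C^q(U, V)`, for an open set `U`. -/
def IsCq {U : Set (EuclideanSpace ℝ (Fin m))} (q : ℕ) (F : U → V) : Prop :=
  ContDiffOn ℝ (q : WithTop ℕ∞) (extendZero F) U

/-- `F ∈ C^q_0(U, V)`, for an open set `U`: all `∂^α F`, `|α| ≤ q`, are continuous and vanish at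
infinity on `U`. -/
def IsC0q {U : Set (EuclideanSpace ℝ (Fin m))} (q : ℕ) (F : U → V) : Prop :=
  IsCq q F ∧ ∀ α : MultiIndex m q,
    Continuous (dAlpha α.1 F) ∧ Tendsto (dAlpha α.1 F) (cocompact U) (𝓝 0)

/-- A family `(G_α)` is the family of derivatives `(∂^α F)` of an element `F = G_0` of
`C^q(A, V)`: `F` is `C^q` on the interior of `A`, and `∂^α F` has the continuous extension `G_α`
to `A`. -/
def IsCqCompact {A : Set (EuclideanSpace ℝ (Fin m))} {q : ℕ} (G : MultiIndex m q → A → V) : Prop :=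
  (∀ α, Continuous (G α)) ∧
  ContDiffOn ℝ (q : WithTop ℕ∞) (extendZero (G (zeroIndex m q))) (interior A) ∧
  ∀ α, ∀ x : A, x.1 ∈ interior A → G α x = iterPartial α.1 (extendZero (G (zeroIndex m q))) x

/-- The family `(G_α)` belongs to the closure, in `C^q(A, V)`, of the set of restrictions to `A` of
the elements of `C^q(U, V)`. -/
def IsCqClosure {U A : Set (EuclideanSpace ℝ (Fin m))} (hA : A ⊆ U) {q : ℕ}
    (G : MultiIndex m q → A → V) : Prop :=
  IsCqCompact G ∧ ∀ ε > (0 : ℝ), ∃ g : U → V, IsCq q g ∧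
    ∀ x : A, ∑ α : MultiIndex m q, ‖dAlpha α.1 g (Set.inclusion hA x) - G α x‖ < ε

end Derivatives

variable {H : Type*} [NormedAddCommGroup H] [InnerProductSpace ℂ H] [CompleteSpace H]

/-! ### Vector measures and integrals -/

section Integrals

variable {Z : Type*} [MeasurableSpace Z]

/-- An `H`-valued Radon measure of bounded variation. -/
def IsRadon [TopologicalSpace Z] (η : VectorMeasure Z H) : Prop :=
  IsFiniteMeasure η.variation ∧ η.variation.Regular

/-- The real bilinear pairing `(a, b) ↦ ⟨a, b⟩`, for the inner product that is linear in its first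
and conjugate linear in its second argument (`inner ℂ` is conjugate linear in its first one). -/
def pairing (H : Type*) [NormedAddCommGroup H] [InnerProductSpace ℂ H] : H →L[ℝ] H →L[ℝ] ℂ :=
  LinearMap.mkContinuous₂
    (LinearMap.mk₂ ℝ (fun a b : H => inner ℂ b a)
      (fun a a' b => inner_add_right b a a')
      (fun c a b => by
        rw [← Complex.coe_smul c a, inner_smul_right, Complex.real_smul])
      (fun a b b' => inner_add_left b b' a)
      (fun c a b => by
        rw [← Complex.coe_smul c b, inner_smul_left, Complex.real_smul, Complex.conj_ofReal]))
    1 (fun a b => by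
      simpa [mul_comm] using norm_inner_le_norm (𝕜 := ℂ) b a)

/-- The integral `∫ ⟨F(z), dη(z)⟩` of an `H`-valued function against an `H`-valued measure;
it is meaningful if `F` is Bochner integrable with respect to `|η|`. -/
def bartleIntegral (F : Z → H) (η : VectorMeasure Z H) : ℂ :=
  η.integral F (pairing H)

/-- `T : Z → L(H)` is weak-Bochner integrable with respect to `η`. -/
def WeakBochnerIntegrable (T : Z → H →L[ℂ] H) (η : VectorMeasure Z H) : Prop :=
  (∀ v : H, Integrable (fun z => T z v) η.variation) ∧
    Continuous fun v : H => bartleIntegral (fun z => T z v) η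

open Classical in
/-- The weak-Bochner integral `∫ T(z) dη(z)`: the unique vector `w` of `H` with
`⟨v, w⟩ = ∫ ⟨T(z) v, dη(z)⟩` for all `v`, where `⟨·, ·⟩` is linear in its first argument. -/
def weakBochnerIntegral (T : Z → H →L[ℂ] H) (η : VectorMeasure Z H) : H :=
  if h : ∃ w : H, ∀ v : H, inner ℂ w v = bartleIntegral (fun z => T z v) η then h.choose else 0

end Integrals

/-! ### Operator valued kernels, their Hilbert spaces and their derivatives -/

/-- Positive definiteness of an operator valued kernel:
`∑ ⟨K(x_i, x_j) v_j, v_i⟩ ≥ 0` for all finitely many distinct points and all vectors. -/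
def IsPositiveDefiniteKernel {X : Type*} (K : X → X → H →L[ℂ] H) : Prop :=
  ∀ (s : Finset X) (v : X → H), 0 ≤ ∑ x ∈ s, ∑ y ∈ s, inner ℂ (v x) (K x y (v y))

theorem IsPositiveDefiniteKernel.posSemidef {X : Type*} {K : X → X → H →L[ℂ] H}
    (hK : IsPositiveDefiniteKernel K) : (Matrix.of K).PosSemidef := by
  classical
  have key : ∀ (x y : X) (v w : H), inner ℂ (K y x v) w = inner ℂ v (K x y w) := by
    have diag : ∀ (x : X) (v : H), (inner ℂ v (K x x v)).im = 0 := by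
      intro x v
      have h := hK {x} fun _ => v
      simp only [Finset.sum_singleton] at h
      exact (Complex.le_def.1 h).2.symm
    have im0 : ∀ (x y : X) (v w : H),
        (inner ℂ v (K x y w)).im + (inner ℂ w (K y x v)).im = 0 := by
      intro x y v w
      by_cases hxy : x = y
      · subst hxy
        have h := diag x (v + w)
        simp only [map_add, inner_add_left, inner_add_right, Complex.add_im, diag x v,
          diag x w] at h
        linarith
      · have h := hK {x, y} fun z => if z = x then v else w
        simp only [Finset.sum_pair hxy, if_true, if_neg (Ne.symm hxy)] at h
        have h2 := (Complex.le_def.1 h).2.symm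
        simp only [Complex.add_im, diag x v, diag y w, Complex.zero_im] at h2
        linarith
    intro x y v w
    rw [← inner_conj_symm]
    have h1 := im0 x y v w
    have h2 := im0 x y v (Complex.I • w)
    simp only [map_smul, inner_smul_left, inner_smul_right, Complex.conj_I, Complex.mul_im,
      Complex.I_re, Complex.I_im, Complex.neg_re, Complex.neg_im] at h2
    apply Complex.ext
    · simp only [Complex.conj_re]
      linarith
    · simp only [Complex.conj_im]
      linarith
  refine ((RKHS.posSemidef_tfae (K := Matrix.of K)).out 0 2 rfl rfl).2 ⟨?_, fun f => ?_⟩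
  · refine Matrix.IsHermitian.ext fun x y => ?_
    refine ContinuousLinearMap.ext fun w => ext_inner_left ℂ fun v => ?_
    rw [ContinuousLinearMap.star_eq_adjoint, ContinuousLinearMap.adjoint_inner_right]
    exact key x y v w
  · have h := (Complex.le_def.1 (hK f.support f)).1
    have e : (f.sum fun x w => f.sum fun x' w' => inner ℂ ((Matrix.of K) x' x w) w') =
        ∑ x ∈ f.support, ∑ y ∈ f.support, inner ℂ (f x) (K x y (f y)) := by
      simp only [Finsupp.sum, Matrix.of_apply]
      exact Finset.sum_congr rfl fun x _ => Finset.sum_congr rfl fun y _ => key x y (f x) (f y)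
    rw [e]
    simpa using h

/-- The reproducing kernel Hilbert space of a positive definite kernel `K`: the completion of the
span of the functions `K(·, x) v`, realized as a space of functions. -/
abbrev KernelSpace {X : Type*} (K : X → X → H →L[ℂ] H) (hK : IsPositiveDefiniteKernel K) : Type _ :=
  haveI : Fact (Matrix.of K).PosSemidef := ⟨hK.posSemidef⟩
  RKHS.OfKernel (Matrix.of K)

section Derivatives

variable {m : ℕ} {U : Set (EuclideanSpace ℝ (Fin m))}

open Classical in
/-- The operator `∂^α L(x)` for an operator valued function `L`, in the strong operator sense: the
operator `v ↦ ∂^α (L(·) v)(x)`. -/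
def strongDeriv (α : Fin m → ℕ) (L : U → H →L[ℂ] H) (x : U) : H →L[ℂ] H :=
  if h : ∃ T : H →L[ℂ] H, ∀ v : H, T v = dAlpha α (fun x' => L x' v) x then h.choose else 0

open Classical in
/-- The operator `∂^β L(y)` for an operator valued function `L`, in the weak operator sense: the
operator whose matrix coefficients are the derivatives `∂^β` at `y` of those of `L`. It coincides
with the derivative in the strong operator sense, or in operator norm, when these exist. -/
def weakDeriv (β : Fin m → ℕ) (L : U → H →L[ℂ] H) (y : U) : H →L[ℂ] H :=
  if h : ∃ T : H →L[ℂ] H, ∀ u v : H, inner ℂ u (T v) = dAlpha β (fun y' => inner ℂ u (L y' v)) y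
  then h.choose else 0

/-- The operator `∂₂^β K(x, y)`. -/
def deriv₂ (K : U → U → H →L[ℂ] H) (β : Fin m → ℕ) (x y : U) : H →L[ℂ] H :=
  weakDeriv β (fun y' => K x y') y

/-- The operator `∂₁^α K(x, y)`. -/
def deriv₁ (K : U → U → H →L[ℂ] H) (α : Fin m → ℕ) (x y : U) : H →L[ℂ] H :=
  strongDeriv α (fun x' => K x' y) x

/-- The operator `∂₁^α [∂₂^β K(x, y)]`. -/
def deriv₁₂ (K : U → U → H →L[ℂ] H) (α β : Fin m → ℕ) (x y : U) : H →L[ℂ] H :=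
  deriv₁ (fun x' y' => deriv₂ K β x' y') α x y

/-- The derivatives `∂₁^α [∂₂^β K(x, y)]`, `|α|, |β| ≤ q`, exist as bounded operators, and the
functions `x ↦ ∂₂^β K(x, y) v` have the property `C` (which is `C^q` or `C^q_0`). -/
def HasKernelDerivatives (q : ℕ) (K : U → U → H →L[ℂ] H) (C : (U → H) → Prop) : Prop :=
  (∀ (x : U) (u v : H), IsCq q fun y => inner ℂ u (K x y v)) ∧
  (∀ (β : MultiIndex m q) (x y : U) (u v : H),
    inner ℂ u (deriv₂ K β.1 x y v) = dAlpha β.1 (fun y' => inner ℂ u (K x y' v)) y) ∧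
  (∀ (β : MultiIndex m q) (y : U) (v : H), C fun x => deriv₂ K β.1 x y v) ∧
  (∀ (α β : MultiIndex m q) (x y : U) (v : H),
    deriv₁₂ K α.1 β.1 x y v = dAlpha α.1 (fun x' => deriv₂ K β.1 x' y v) x) ∧
  ∀ (α : MultiIndex m q) (x y : U), deriv₁₂ K α.1 0 x y = deriv₁ K α.1 x y

/-! ### Kernel potentials of families of measures -/

section Potential

/- A family `η = (η_α)` of measures lives on a space `Z`, which is `U` itself or a compact subset
of `U`; `ι` is the inclusion of `Z` in `U`. -/
variable {Z : Type*} [MeasurableSpace Z] {q : ℕ}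

/-- `K_η(y) = ∑_α ∫ ∂₁^α K(x, y) dη_α(x)`. -/
def kernelPotential (K : U → U → H →L[ℂ] H) (ι : Z → U)
    (η : MultiIndex m q → VectorMeasure Z H) : U → H :=
  fun y => ∑ α, weakBochnerIntegral (fun x => deriv₁ K α.1 (ι x) y) (η α)

/-- `∫ ∂₁^α [∂₂^β K(x, y)] dη_α(x)`. -/
def potentialTerm (K : U → U → H →L[ℂ] H) (ι : Z → U)
    (η : MultiIndex m q → VectorMeasure Z H) (α β : MultiIndex m q) (y : U) : H :=
  weakBochnerIntegral (fun x => deriv₁₂ K α.1 β.1 (ι x) y) (η α)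

/-- The function `K_η` is the element `k` of the Hilbert space of `K`; all the integrals in its
definition exist. -/
def IsPotential (K : U → U → H →L[ℂ] H) (hK : IsPositiveDefiniteKernel K) (ι : Z → U)
    (η : MultiIndex m q → VectorMeasure Z H) (k : KernelSpace K hK) : Prop :=
  (∀ (α : MultiIndex m q) (y : U),
    WeakBochnerIntegrable (fun x => deriv₁ K α.1 (ι x) y) (η α)) ∧
  (k : U → H) = kernelPotential K ι η

/-- For all `|β| ≤ q`, `∂^β K_η(y) = ∑_α ∫ ∂₁^α [∂₂^β K(x, y)] dη_α(x)`. -/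
def DerivativeFormula (K : U → U → H →L[ℂ] H) (ι : Z → U)
    (η : MultiIndex m q → VectorMeasure Z H) : Prop :=
  ∀ (β : MultiIndex m q) (y : U),
    (∀ α : MultiIndex m q,
      WeakBochnerIntegrable (fun x => deriv₁₂ K α.1 β.1 (ι x) y) (η α)) ∧
    dAlpha β.1 (kernelPotential K ι η) y = ∑ α, potentialTerm K ι η α β y

/-- `N = ∑_{α, β} ∫ ⟨∫ ∂₁^α [∂₂^β K(x, y)] dη_α(x), dη_β(y)⟩`. -/
def DoubleIntegralFormula (K : U → U → H →L[ℂ] H) (ι : Z → U)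
    (η : MultiIndex m q → VectorMeasure Z H) (N : ℂ) : Prop :=
  (∀ α β : MultiIndex m q,
    Integrable (fun y => potentialTerm K ι η α β (ι y)) (η β).variation) ∧
  N = ∑ α, ∑ β, bartleIntegral (fun y => potentialTerm K ι η α β (ι y)) (η β)

/-- If `dη_α = h_α dμ` for a finite measure `μ` and Bochner integrable functions `h_α`, then
`N = ∑_{α, β} ∫ ∫ ⟨∂₁^α [∂₂^β K(x, y)] h_β(y), h_α(x)⟩ dμ(x) dμ(y)`. -/
def DensityFormula (K : U → U → H →L[ℂ] H) (ι : Z → U)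
    (η : MultiIndex m q → VectorMeasure Z H) (N : ℂ) : Prop :=
  ∀ (μ : Measure Z) (h : MultiIndex m q → Z → H), IsFiniteMeasure μ →
    (∀ α, Integrable (h α) μ) →
    (∀ α, ∀ s : Set Z, MeasurableSet s → η α s = ∫ z in s, h α z ∂μ) →
    (∀ (α β : MultiIndex m q) (y : Z),
      Integrable (fun x => inner ℂ (h α x) (deriv₁₂ K α.1 β.1 (ι x) (ι y) (h β y))) μ) ∧
    (∀ α β : MultiIndex m q, Integrable
      (fun y => ∫ x, inner ℂ (h α x) (deriv₁₂ K α.1 β.1 (ι x) (ι y) (h β y)) ∂μ) μ) ∧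
    N = ∑ α, ∑ β, ∫ y, ∫ x,
      inner ℂ (h α x) (deriv₁₂ K α.1 β.1 (ι x) (ι y) (h β y)) ∂μ ∂μ

end Potential

/-! ### Universality -/

/-- `C^q`-universality. -/
def IsCqUniversal (q : ℕ) (K : U → U → H →L[ℂ] H) (hK : IsPositiveDefiniteKernel K) : Prop :=
  (∀ F : KernelSpace K hK, IsCq q (F : U → H)) ∧
  ∀ A : Set U, IsCompact A → ∀ g : U → H, IsCq q g → ∀ ε > (0 : ℝ),
    ∃ f : KernelSpace K hK, ∀ x ∈ A,
      ∑ α : MultiIndex m q, ‖dAlpha α.1 (f : U → H) x - dAlpha α.1 g x‖ < ε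

/-- `C^q_0`-universality. -/
def IsC0qUniversal (q : ℕ) (K : U → U → H →L[ℂ] H) (hK : IsPositiveDefiniteKernel K) : Prop :=
  (∀ F : KernelSpace K hK, IsC0q q (F : U → H)) ∧
  ∀ g : U → H, IsC0q q g → ∀ ε > (0 : ℝ),
    ∃ f : KernelSpace K hK, ∀ x : U,
      ∑ α : MultiIndex m q, ‖dAlpha α.1 (f : U → H) x - dAlpha α.1 g x‖ < ε

end Derivatives

end

/-! ### Calculus of iterated partial derivatives -/

section PartialDerivatives

variable {m : ℕ} {V V' : Type*} [NormedAddCommGroup V] [NormedSpace ℝ V]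
  [NormedAddCommGroup V'] [NormedSpace ℝ V']
  {U : Set (EuclideanSpace ℝ (Fin m))}

/-! Everything follows from one factorization. Let `E x` be evaluation at `x` on the kernel space,
so that `K x y = E x ∘ (E y)*`. By Banach–Steinhaus, derivative evaluation `D α x : f ↦ ∂^α f(x)` is
a bounded operator, being obtained by successive pointwise limits of difference quotients, and
therefore `∂₁^α[∂₂^β K(x, y)] = D α x ∘ (D β y)*` (`deriv₁₂_eq`).

Each `∂^α f` is bounded on `Z`, because it vanishes at infinity or because `Z` is compact.
Banach–Steinhaus then bounds the operators `D α z` uniformly in `z`, so `f ↦ ∑ ∫ ⟨∂^α f, dη_α⟩` is a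
bounded functional on the kernel space. Its Riesz vector is `K_η`: applying `E y` to it gives (i),
`D β y` gives (ii), and pairing it with itself gives (iii) (`exists_potential`).

For (iv), `K_η` has positive norm exactly when this functional does not vanish on the kernel space.
The positivity condition thus says that a family of measures annihilating the kernel space
annihilates the whole function space. Universality implies this by continuity. Conversely, `f ↦ (∂^α
f)_α` maps into a finite power of `C₀(Z, H)`, and Hahn–Banach gives density once functionals on
`C₀(Z, H)` are known to be Radon measures (`exists_isRadon_bartleIntegral_eq`). For that, the total
variation of a functional `L` is a positive functional on `C_c`, hence a finite measure `μ` with `‖L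
F‖ ≤ ∫ ‖F‖ dμ`; `L` extends to `L¹(μ, H)`, and its values on indicators define the vector measure.
-/

theorem foldr_iterate_rel {X Y : Type*} (d : Fin m → X → X) (d' : Fin m → Y → Y)
    (R : ℕ → X → Y → Prop)
    (step : ∀ n i x y, R (n + 1) x y → R n (d i x) (d' i y)) (α : Fin m → ℕ)
    (n : ℕ) (x : X) (y : Y) (h : R (n + ∑ i, α i) x y) :
    R n ((List.finRange m).foldr (fun i g => (d i)^[α i] g) x)
      ((List.finRange m).foldr (fun i g => (d' i)^[α i] g) y) := by
  -- The index of `R` counts the derivatives still available; each step uses up one of them.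
  have iter : ∀ (i : Fin m) (k n : ℕ) (x : X) (y : Y), R (n + k) x y →
      R n ((d i)^[k] x) ((d' i)^[k] y) := by
    intro i k
    induction k with
    | zero => intro n x y h; simpa using h
    | succ k ih =>
      intro n x y h
      rw [Function.iterate_succ_apply, Function.iterate_succ_apply]
      exact ih n _ _ (step _ i _ _ (by rwa [← add_assoc] at h))
  have main : ∀ (l : List (Fin m)) (n : ℕ), R (n + (l.map α).sum) x y →
      R n (l.foldr (fun i g => (d i)^[α i] g) x) (l.foldr (fun i g => (d' i)^[α i] g) y) := by
    intro l
    induction l with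
    | nil => intro n h; simpa using h
    | cons i l ih =>
      intro n h
      simp only [List.foldr_cons]
      refine iter i _ _ _ _ (ih _ ?_)
      rw [List.map_cons, List.sum_cons] at h
      rwa [add_assoc]
  refine main _ n ?_
  rwa [← Fin.sum_univ_def]

theorem iterPartial_rel (R : ℕ → (EuclideanSpace ℝ (Fin m) → V) →
      (EuclideanSpace ℝ (Fin m) → V') → Prop)
    (step : ∀ n i f g, R (n + 1) f g → R n (partialDeriv i f) (partialDeriv i g))
    (α : Fin m → ℕ) (n : ℕ) (f : EuclideanSpace ℝ (Fin m) → V)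
    (g : EuclideanSpace ℝ (Fin m) → V') (h : R (n + ∑ i, α i) f g) :
    R n (iterPartial α f) (iterPartial α g) :=
  foldr_iterate_rel partialDeriv partialDeriv R step α n f g h

/-- Induction along the definition of `iterPartial α`, for families of functions. -/
theorem iterPartial_family {J : Type*} (P : ℕ → (J → EuclideanSpace ℝ (Fin m) → V) → Prop)
    (step : ∀ n i f, P (n + 1) f → P n (fun j => partialDeriv i (f j)))
    (α : Fin m → ℕ) (n : ℕ) (f : J → EuclideanSpace ℝ (Fin m) → V) (h : P (n + ∑ i, α i) f) :
    P n (fun j => iterPartial α (f j)) := by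
  let d : Fin m → (J → EuclideanSpace ℝ (Fin m) → V) → (J → EuclideanSpace ℝ (Fin m) → V) :=
    fun i f j => partialDeriv i (f j)
  -- Differentiating all members at once agrees with differentiating each one: use the relation `g =
  -- F j`.
  have e : (fun j => iterPartial α (f j)) =
      (List.finRange m).foldr (fun i g => (d i)^[α i] g) f := by
    funext j
    exact foldr_iterate_rel partialDeriv d (fun _ g F => g = F j)
      (fun n i x y h => by simp only [d, h]) α 0 (f j) f rfl
  rw [e]
  exact foldr_iterate_rel d d (fun n F _ => P n F) (fun n i x _ h => step n i x h) α n f f h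

@[simp]
theorem iterPartial_zero (f : EuclideanSpace ℝ (Fin m) → V) : iterPartial 0 f = f := by
  simp only [iterPartial, Pi.zero_apply, Function.iterate_zero, id]
  induction List.finRange m with
  | nil => rfl
  | cons i l ih => simp [ih]

theorem partialDeriv_eq_fderiv {f : EuclideanSpace ℝ (Fin m) → V} {x : EuclideanSpace ℝ (Fin m)}
    (h : DifferentiableAt ℝ f x) (i : Fin m) :
    partialDeriv i f x = fderiv ℝ f x (EuclideanSpace.single i 1) :=
  h.lineDeriv_eq_fderiv

theorem contDiffOn_partialDeriv (hU : IsOpen U) {n : ℕ} {f : EuclideanSpace ℝ (Fin m) → V}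
    (hf : ContDiffOn ℝ ((n + 1 : ℕ) : WithTop ℕ∞) f U) (i : Fin m) :
    ContDiffOn ℝ (n : WithTop ℕ∞) (partialDeriv i f) U := by
  have h1 : ContDiffOn ℝ (n : WithTop ℕ∞) (fderiv ℝ f) U :=
    hf.fderiv_of_isOpen hU (by norm_cast)
  have h2 : ContDiffOn ℝ (n : WithTop ℕ∞)
      (fun x => fderiv ℝ f x (EuclideanSpace.single i (1 : ℝ))) U :=
    h1.clm_apply contDiffOn_const
  refine h2.congr fun x hx => ?_
  exact partialDeriv_eq_fderiv ((hf.differentiableOn (by simp)).differentiableAt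
    (hU.mem_nhds hx)) i

theorem eqOn_partialDeriv (hU : IsOpen U) {f g : EuclideanSpace ℝ (Fin m) → V}
    (h : Set.EqOn f g U) (i : Fin m) : Set.EqOn (partialDeriv i f) (partialDeriv i g) U :=
  fun _ hx => (h.eventuallyEq_of_mem (hU.mem_nhds hx)).lineDeriv_eq

theorem eqOn_iterPartial (hU : IsOpen U) {f g : EuclideanSpace ℝ (Fin m) → V}
    (h : Set.EqOn f g U) (α : Fin m → ℕ) : Set.EqOn (iterPartial α f) (iterPartial α g) U :=
  iterPartial_rel (fun _ f g => Set.EqOn f g U) (fun _ i _ _ h => eqOn_partialDeriv hU h i)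
    α 0 f g h

theorem contDiffOn_iterPartial (hU : IsOpen U) {q : ℕ} {f : EuclideanSpace ℝ (Fin m) → V}
    (hf : ContDiffOn ℝ (q : WithTop ℕ∞) f U) {α : Fin m → ℕ} (hα : ∑ i, α i ≤ q) :
    ContDiffOn ℝ ((q - ∑ i, α i : ℕ) : WithTop ℕ∞) (iterPartial α f) U :=
  iterPartial_rel (fun n (f : _ → V) (_ : _ → V) => ContDiffOn ℝ (n : WithTop ℕ∞) f U)
    (fun _ i _ _ h => contDiffOn_partialDeriv hU h i) α _ f f (by rwa [Nat.sub_add_cancel hα])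

theorem continuousOn_iterPartial (hU : IsOpen U) {q : ℕ} {f : EuclideanSpace ℝ (Fin m) → V}
    (hf : ContDiffOn ℝ (q : WithTop ℕ∞) f U) {α : Fin m → ℕ} (hα : ∑ i, α i ≤ q) :
    ContinuousOn (iterPartial α f) U :=
  (contDiffOn_iterPartial hU hf hα).continuousOn

/-- The chain rule, one derivative at a time. The remaining smoothness of `f` is carried in the
relation, since each step needs differentiability. -/
theorem eqOn_iterPartial_clm (hU : IsOpen U) {q : ℕ} {f : EuclideanSpace ℝ (Fin m) → V}
    (hf : ContDiffOn ℝ (q : WithTop ℕ∞) f U) (L : V →L[ℝ] V') {α : Fin m → ℕ}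
    (hα : ∑ i, α i ≤ q) :
    Set.EqOn (iterPartial α (L ∘ f)) (L ∘ iterPartial α f) U := by
  refine (iterPartial_rel (fun n (f : _ → V) (g : _ → V') =>
    ContDiffOn ℝ (n : WithTop ℕ∞) f U ∧ Set.EqOn g (L ∘ f) U)
    (fun n i f g h => ⟨contDiffOn_partialDeriv hU h.1 i, fun x hx => ?_⟩) α (q - ∑ i, α i) f
    (L ∘ f) ⟨by rwa [Nat.sub_add_cancel hα], fun _ _ => rfl⟩).2
  have hd : DifferentiableAt ℝ f x :=
    (h.1.differentiableOn (by simp)).differentiableAt (hU.mem_nhds hx)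
  rw [eqOn_partialDeriv hU h.2 i hx, Function.comp_apply, partialDeriv_eq_fderiv hd,
    partialDeriv_eq_fderiv (L.differentiableAt.comp x hd),
    fderiv_comp x L.differentiableAt hd, L.fderiv, ContinuousLinearMap.comp_apply]

end PartialDerivatives

/-! ### Boundedness of derivative evaluations -/

section Parameters

variable {m : ℕ} {V : Type*} [NormedAddCommGroup V] [NormedSpace ℂ V]
  {U : Set (EuclideanSpace ℝ (Fin m))} {W : Type*} [NormedAddCommGroup W] [NormedSpace ℂ W]
  [CompleteSpace W]

/-- Banach–Steinhaus: partial derivatives of functions depending linearly and, pointwise,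
continuously on a parameter in a Banach space inherit this property. -/
theorem exists_clm_partialDeriv (hU : IsOpen U) {T : W → EuclideanSpace ℝ (Fin m) → V}
    (hd : ∀ f, DifferentiableOn ℝ (T f) U)
    (hT : ∀ x ∈ U, ∃ D : W →L[ℂ] V, ∀ f, D f = T f x) (i : Fin m) :
    ∀ x ∈ U, ∃ D : W →L[ℂ] V, ∀ f, D f = partialDeriv i (T f) x := by
  classical
  intro x hx
  have hT' : ∀ y, ∃ D : W →L[ℂ] V, y ∈ U → ∀ f, D f = T f y := fun y => by
    by_cases hy : y ∈ U
    · obtain ⟨D, hD⟩ := hT y hy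
      exact ⟨D, fun _ => hD⟩
    · exact ⟨0, fun h => absurd h hy⟩
  choose D hD using hT'
  set e : EuclideanSpace ℝ (Fin m) := EuclideanSpace.single i 1
  -- Difference quotients as operators. The real scalar is cast to `ℂ` to keep them complex linear;
  -- the choice of `D` outside `U` does not matter, since `x + t • e ∈ U` for small `t`.
  let g : ℝ → W →L[ℂ] V := fun t => ((t : ℂ)⁻¹) • (D (x + t • e) - D x)
  have hg : Tendsto (fun t f => g t f) (𝓝[≠] 0) (𝓝 fun f => partialDeriv i (T f) x) := by
    rw [tendsto_pi_nhds]
    intro f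
    have h1 := (((hd f).differentiableAt (hU.mem_nhds hx)).lineDifferentiableAt
      (v := e)).hasLineDerivAt.tendsto_slope_zero
    refine h1.congr' ?_
    have h2 : ∀ᶠ t : ℝ in 𝓝[≠] 0, x + t • e ∈ U := by
      refine nhdsWithin_le_nhds ?_
      have hc : Continuous fun t : ℝ => x + t • e := by fun_prop
      exact hc.continuousAt.preimage_mem_nhds (hU.mem_nhds (by simpa using hx))
    filter_upwards [h2] with t ht
    simp only [g, smul_apply, sub_apply, hD _ ht, hD _ hx]
    rw [← Complex.ofReal_inv, Complex.coe_smul]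
  exact ⟨continuousLinearMapOfTendsto g hg, fun f => rfl⟩

/-- Both smoothness and continuity in the parameter survive a partial derivative, so
`exists_clm_partialDeriv` can be iterated. -/
theorem exists_clm_iterPartial (hU : IsOpen U) {q : ℕ} {T : W → EuclideanSpace ℝ (Fin m) → V}
    (hd : ∀ f, ContDiffOn ℝ (q : WithTop ℕ∞) (T f) U)
    (hT : ∀ x ∈ U, ∃ D : W →L[ℂ] V, ∀ f, D f = T f x) {α : Fin m → ℕ} (hα : ∑ i, α i ≤ q) :
    ∀ x ∈ U, ∃ D : W →L[ℂ] V, ∀ f, D f = iterPartial α (T f) x :=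
  (iterPartial_family (fun n (T : W → EuclideanSpace ℝ (Fin m) → V) =>
    (∀ f, ContDiffOn ℝ (n : WithTop ℕ∞) (T f) U) ∧
      ∀ x ∈ U, ∃ D : W →L[ℂ] V, ∀ f, D f = T f x)
    (fun _ i _ h => ⟨fun f => contDiffOn_partialDeriv hU (h.1 f) i,
      exists_clm_partialDeriv hU (fun f => (h.1 f).differentiableOn (by simp)) h.2 i⟩)
    α (q - ∑ i, α i) T ⟨by rwa [Nat.sub_add_cancel hα], hT⟩).2

end Parameters

/-! ### Derivatives of functions on open sets -/

section OpenSets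

variable {m q : ℕ} {V V' : Type*} [NormedAddCommGroup V] [NormedSpace ℝ V]
  [NormedAddCommGroup V'] [NormedSpace ℝ V']
  {U : Set (EuclideanSpace ℝ (Fin m))}

omit [NormedSpace ℝ V] in
theorem extendZero_apply (F : U → V) (x : U) : extendZero F x = F x :=
  Subtype.val_injective.extend_apply F 0 x

theorem extendZero_clm_comp (L : V →L[ℝ] V') (F : U → V) :
    extendZero (fun x => L (F x)) = L ∘ extendZero F := by
  funext x
  by_cases hx : x ∈ U
  · have := extendZero_apply F ⟨x, hx⟩
    simpa [extendZero_apply (fun x => L (F x)) ⟨x, hx⟩] using (congrArg L this).symm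
  · have h : ¬ ∃ a : U, a.1 = x := by rintro ⟨a, rfl⟩; exact hx a.2
    simp [extendZero, Function.extend_apply' _ _ _ h]

@[simp]
theorem dAlpha_zero (F : U → V) : dAlpha 0 F = F := by
  funext x
  simp [dAlpha, extendZero_apply]

theorem dAlpha_zeroIndex (F : U → V) : dAlpha (zeroIndex m q).1 F = F :=
  dAlpha_zero F

theorem IsCq.continuous_dAlpha (hU : IsOpen U) {F : U → V} (hF : IsCq q F) (α : MultiIndex m q) :
    Continuous (dAlpha α.1 F) :=
  continuousOn_iff_continuous_domRestrict.1
    (continuousOn_iterPartial hU hF (mem_multiIndices.1 α.2))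

theorem IsCq.clm_comp {F : U → V} (hF : IsCq q F) (L : V →L[ℝ] V') :
    IsCq q fun x => L (F x) := by
  rw [IsCq, extendZero_clm_comp]
  exact L.contDiff.comp_contDiffOn hF

theorem IsCq.dAlpha_clm_comp (hU : IsOpen U) {F : U → V} (hF : IsCq q F) (L : V →L[ℝ] V')
    (α : MultiIndex m q) (x : U) : dAlpha α.1 (fun x => L (F x)) x = L (dAlpha α.1 F x) := by
  rw [dAlpha, extendZero_clm_comp]
  exact eqOn_iterPartial_clm hU hF L (mem_multiIndices.1 α.2) x.2

end OpenSets

/-- If pointwise evaluation is continuous on a Banach space of `C^q` functions, then so are the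
evaluations of the derivatives of order at most `q`. -/
theorem exists_clm_dAlpha {m q : ℕ} {V : Type*} [NormedAddCommGroup V] [NormedSpace ℂ V]
    {U : Set (EuclideanSpace ℝ (Fin m))} (hU : IsOpen U) {W : Type*} [NormedAddCommGroup W]
    [NormedSpace ℂ W] [CompleteSpace W] (E : U → W →L[ℂ] V)
    (hE : ∀ f, IsCq q fun x => E x f) :
    ∃ D : MultiIndex m q → U → W →L[ℂ] V, ∀ α x f, D α x f = dAlpha α.1 (fun x => E x f) x := by
  have h := fun (α : MultiIndex m q) (x : U) => exists_clm_iterPartial hU hE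
    (fun x hx => ⟨E ⟨x, hx⟩, fun f => (extendZero_apply (fun x => E x f) ⟨x, hx⟩).symm⟩)
    (mem_multiIndices.1 α.2) x x.2
  choose D hD using h
  exact ⟨D, hD⟩

/-! ### Integrals of vector functions against vector measures -/

section Integrals

variable {H : Type*} [NormedAddCommGroup H] [InnerProductSpace ℂ H]
  {Z : Type*} [MeasurableSpace Z]

@[simp]
theorem pairing_apply (a b : H) : pairing H a b = inner ℂ b a := rfl

theorem norm_pairing_le : ‖pairing H‖ ≤ 1 :=
  LinearMap.mkContinuous₂_norm_le _ zero_le_one _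

/-- Induction principle for bounded strongly measurable functions. -/
theorem bounded_stronglyMeasurable_induction (P : (Z → H) → Prop)
    (ind : ∀ (v : H) (s : Set Z), MeasurableSet s → P (s.indicator fun _ => v))
    (add : ∀ f g : SimpleFunc Z H, P f → P g → P (f + g))
    (lim : ∀ (F : ℕ → SimpleFunc Z H) (f : Z → H) (C : ℝ), StronglyMeasurable f →
      (∀ n x, ‖F n x‖ ≤ C) → (∀ x, Tendsto (fun n => F n x) atTop (𝓝 (f x))) →
      (∀ n, P (F n)) → P f)
    {f : Z → H} (hf : StronglyMeasurable f) {C : ℝ} (hC : ∀ x, ‖f x‖ ≤ C) : P f := by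
  classical
  have hs : ∀ g : SimpleFunc Z H, P g := by
    intro g
    induction g using SimpleFunc.induction with
    | const c hs =>
      convert ind c _ hs using 1
      funext z
      simp [Set.piecewise, Set.indicator]
    | add _ h1 h2 => exact add _ _ h1 h2
  -- The bound `C` is known to be nonnegative only if `Z` has a point.
  rcases isEmpty_or_nonempty Z with hZ | ⟨⟨z⟩⟩
  · have : f = ((0 : SimpleFunc Z H) : Z → H) := funext fun z => isEmptyElim z
    rw [this]
    exact hs 0
  · have h0 : 0 ≤ C := (norm_nonneg _).trans (hC z)
    exact lim (fun n => hf.approxBounded C n) f C hf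
      (fun n x => hf.norm_approxBounded_le h0 n x)
      (fun x => hf.tendsto_approxBounded_of_norm_le (hC x)) (fun n => hs _)

variable {η : VectorMeasure Z H}

omit [InnerProductSpace ℂ H] in
theorem integrable_of_bounded {μ : Measure Z} [IsFiniteMeasure μ] {f : Z → H}
    (hf : StronglyMeasurable f) {C : ℝ} (hC : ∀ x, ‖f x‖ ≤ C) : Integrable f μ :=
  Integrable.of_bound hf.aestronglyMeasurable C (Eventually.of_forall hC)

theorem bartleIntegral_add {f g : Z → H} (hf : Integrable f η.variation)
    (hg : Integrable g η.variation) :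
    bartleIntegral (f + g) η = bartleIntegral f η + bartleIntegral g η :=
  VectorMeasure.integral_add hf hg

theorem bartleIntegral_sub {f g : Z → H} (hf : Integrable f η.variation)
    (hg : Integrable g η.variation) :
    bartleIntegral (fun z => f z - g z) η = bartleIntegral f η - bartleIntegral g η :=
  VectorMeasure.integral_fun_sub hf hg

theorem bartleIntegral_indicator [IsFiniteMeasure η.variation] (v : H) {s : Set Z}
    (hs : MeasurableSet s) :
    bartleIntegral (s.indicator fun _ => v) η = inner ℂ (η s) v := by
  rw [bartleIntegral, VectorMeasure.integral_eq_setToFun,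
    setToFun_indicator_const _ hs (by finiteness)]
  rfl

theorem norm_bartleIntegral_le [IsFiniteMeasure η.variation] {f : Z → H} {C : ℝ}
    (hC : ∀ z, ‖f z‖ ≤ C) : ‖bartleIntegral f η‖ ≤ C * η.variation.real Set.univ := by
  rcases isEmpty_or_nonempty Z with hZ | ⟨⟨z⟩⟩
  · simp [bartleIntegral, VectorMeasure.integral_of_isEmpty, Measure.eq_zero_of_isEmpty]
  have h0 : 0 ≤ C := (norm_nonneg _).trans (hC z)
  refine (VectorMeasure.norm_integral_le_of_norm_le_const (Eventually.of_forall hC)).trans ?_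
  exact mul_le_mul_of_nonneg_right (mul_le_of_le_one_right h0 norm_pairing_le) measureReal_nonneg

theorem tendsto_bartleIntegral [IsFiniteMeasure η.variation] {F : ℕ → Z → H} {f : Z → H} {C : ℝ}
    (hF : ∀ n, StronglyMeasurable (F n)) (hC : ∀ n z, ‖F n z‖ ≤ C)
    (hl : ∀ z, Tendsto (fun n => F n z) atTop (𝓝 (f z))) :
    Tendsto (fun n => bartleIntegral (F n) η) atTop (𝓝 (bartleIntegral f η)) :=
  VectorMeasure.tendsto_integral_of_dominated_convergence (fun _ => C)
    (fun n => (hF n).aestronglyMeasurable) (integrable_const C)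
    (fun n => Eventually.of_forall (hC n)) (Eventually.of_forall hl)

/-- The pairing is only real bilinear, so complex homogeneity must be checked on indicators and
passed to limits. -/
theorem bartleIntegral_smul [IsFiniteMeasure η.variation] (c : ℂ) {f : Z → H}
    (hf : StronglyMeasurable f) {C : ℝ} (hC : ∀ z, ‖f z‖ ≤ C) :
    bartleIntegral (fun z => c • f z) η = c * bartleIntegral f η := by
  refine bounded_stronglyMeasurable_induction
    (fun f => bartleIntegral (fun z => c • f z) η = c * bartleIntegral f η) ?_ ?_ ?_ hf hC
  · intro v s hs
    have : (fun z => c • s.indicator (fun _ => v) z) = s.indicator fun _ => c • v := by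
      funext z
      by_cases hz : z ∈ s <;> simp [hz]
    rw [this, bartleIntegral_indicator _ hs, bartleIntegral_indicator _ hs, inner_smul_right]
  · intro f g hf hg
    have hi : ∀ f : SimpleFunc Z H, Integrable f η.variation := fun f =>
      SimpleFunc.integrable_of_isFiniteMeasure f
    have hi' : ∀ f : SimpleFunc Z H, Integrable (fun z => c • f z) η.variation := fun f =>
      (hi f).smul c
    have e : (fun z => c • ((f : Z → H) + g) z) = (fun z => c • f z) + fun z => c • g z := by
      funext z
      simp
    rw [e, bartleIntegral_add (hi' f) (hi' g), bartleIntegral_add (hi f) (hi g), hf, hg, mul_add]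
  · intro F f C _ hC hl hP
    have h1 := tendsto_bartleIntegral (η := η) (fun n => (F n).stronglyMeasurable) hC hl
    have h2 := tendsto_bartleIntegral (η := η) (F := fun n z => c • F n z)
      (f := fun z => c • f z) (C := ‖c‖ * C)
      (fun n => (F n).stronglyMeasurable.const_smul c)
      (fun n z => by rw [norm_smul]; exact mul_le_mul_of_nonneg_left (hC n z) (norm_nonneg c))
      (fun z => (hl z).const_smul c)
    refine tendsto_nhds_unique h2 ?_
    simp only [hP]
    exact h1.const_mul c

/-- The integral against a measure with density. -/
theorem bartleIntegral_eq_integral_density [IsFiniteMeasure η.variation] [CompleteSpace H]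
    {μ : Measure Z} {h : Z → H}
    (hh : Integrable h μ) (hη : ∀ s, MeasurableSet s → η s = ∫ z in s, h z ∂μ) {f : Z → H}
    (hf : StronglyMeasurable f) {C : ℝ} (hC : ∀ z, ‖f z‖ ≤ C) :
    bartleIntegral f η = ∫ z, inner ℂ (h z) (f z) ∂μ := by
  have bound : ∀ {f : Z → H} {C : ℝ}, (∀ z, ‖f z‖ ≤ C) →
      ∀ z, ‖inner ℂ (h z) (f z)‖ ≤ ‖h z‖ * C := fun hC z =>
    (norm_inner_le_norm _ _).trans (mul_le_mul_of_nonneg_left (hC z) (norm_nonneg _))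
  refine bounded_stronglyMeasurable_induction
    (fun f => bartleIntegral f η = ∫ z, inner ℂ (h z) (f z) ∂μ) ?_ ?_ ?_ hf hC
  · intro v s hs
    rw [bartleIntegral_indicator _ hs, hη s hs]
    have : (fun z => inner ℂ (h z) (s.indicator (fun _ => v) z)) =
        s.indicator fun z => inner ℂ (h z) v := by
      funext z
      by_cases hz : z ∈ s <;> simp [hz]
    -- The integral can be taken out of the linear slot of the inner product, so the conjugate is
    -- integrated instead.
    rw [this, integral_indicator hs, ← inner_conj_symm, ← integral_inner hh.integrableOn v,
      ← integral_conj]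
    simp only [inner_conj_symm]
  · intro f g hf hg
    have hi : ∀ f : SimpleFunc Z H, Integrable f η.variation := fun f =>
      SimpleFunc.integrable_of_isFiniteMeasure f
    have hi' : ∀ f : SimpleFunc Z H, Integrable (fun z => inner ℂ (h z) (f z)) μ := fun f => by
      obtain ⟨C, hC⟩ := f.exists_forall_norm_le
      exact (hh.norm.mul_const C).mono' (hh.aestronglyMeasurable.inner
        f.stronglyMeasurable.aestronglyMeasurable) (Eventually.of_forall (bound hC))
    rw [bartleIntegral_add (hi f) (hi g), hf, hg, ← integral_add (hi' f) (hi' g)]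
    simp
  · intro F f C _ hC hl hP
    have h1 := tendsto_bartleIntegral (η := η) (fun n => (F n).stronglyMeasurable) hC hl
    simp only [hP] at h1
    refine tendsto_nhds_unique h1 (tendsto_integral_of_dominated_convergence
      (fun z => ‖h z‖ * C) (fun n => hh.aestronglyMeasurable.inner
        (F n).stronglyMeasurable.aestronglyMeasurable) (hh.norm.mul_const C)
      (fun n => Eventually.of_forall (bound (hC n))) (Eventually.of_forall fun z => ?_))
    exact (tendsto_const_nhds (x := h z)).inner (hl z)

theorem weakBochnerIntegral_eq {T : Z → H →L[ℂ] H} {w : H}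
    (hw : ∀ v, inner ℂ w v = bartleIntegral (fun z => T z v) η) :
    weakBochnerIntegral T η = w := by
  have h : ∃ w : H, ∀ v : H, inner ℂ w v = bartleIntegral (fun z => T z v) η := ⟨w, hw⟩
  rw [weakBochnerIntegral, dif_pos h]
  exact ext_inner_right ℂ fun v => (h.choose_spec v).trans (hw v).symm

theorem WeakBochnerIntegrable.of_inner {T : Z → H →L[ℂ] H} {w : H}
    (hT : ∀ v, Integrable (fun z => T z v) η.variation)
    (hw : ∀ v, inner ℂ w v = bartleIntegral (fun z => T z v) η) :
    WeakBochnerIntegrable T η :=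
  ⟨hT, by simp only [← hw]; fun_prop⟩

end Integrals

/-! ### The dual of `C₀(Z, H)` -/

section Riesz

open scoped ZeroAtInfty CompactlySupported NNReal ENNReal

variable {H : Type*} [NormedAddCommGroup H] [InnerProductSpace ℂ H]
  {Z : Type*} [TopologicalSpace Z]

omit [InnerProductSpace ℂ H] in
theorem ZeroAtInftyContinuousMap.norm_apply_le (F : C₀(Z, H)) (x : Z) : ‖F x‖ ≤ ‖F‖ := by
  rw [← ZeroAtInftyContinuousMap.norm_toBCF_eq_norm]
  exact F.toBCF.norm_coe_le_norm x

omit [InnerProductSpace ℂ H] in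
theorem ZeroAtInftyContinuousMap.norm_le_of_forall {F : C₀(Z, H)} {C : ℝ} (hC : 0 ≤ C)
    (h : ∀ x, ‖F x‖ ≤ C) : ‖F‖ ≤ C := by
  rw [← ZeroAtInftyContinuousMap.norm_toBCF_eq_norm]
  exact (BoundedContinuousFunction.norm_le hC).2 h

theorem ZeroAtInftyContinuousMap.exists_smul (F : C₀(Z, H)) {φ : Z → ℝ} (hφ : Continuous φ)
    (h : ∀ x, |φ x| ≤ 1) : ∃ G : C₀(Z, H), ∀ x, G x = φ x • F x := by
  refine ⟨⟨⟨fun x => φ x • F x, hφ.smul F.continuous⟩, ?_⟩, fun x => rfl⟩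
  refine squeeze_zero_norm (fun x => ?_) (tendsto_zero_iff_norm_tendsto_zero.1 F.zero_at_infty')
  change ‖φ x • F x‖ ≤ ‖F x‖
  rw [norm_smul, Real.norm_eq_abs]
  exact mul_le_of_le_one_left (norm_nonneg _) (h x)

/-- The total variation `sup {|L F| : ‖F‖ ≤ f}` of a functional `L` on `C₀(Z, H)`. -/
noncomputable def dualVariation (L : C₀(Z, H) →L[ℂ] ℂ) (f : C_c(Z, ℝ≥0)) : ℝ≥0 :=
  ⨆ F : {F : C₀(Z, H) // ∀ x, ‖F x‖₊ ≤ f x}, ‖L F‖₊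

variable (L : C₀(Z, H) →L[ℂ] ℂ)

theorem exists_bound_of_compactlySupported (f : C_c(Z, ℝ≥0)) : ∃ C : ℝ≥0, ∀ x, f x ≤ C := by
  have h : HasCompactSupport fun x => (f x : ℝ) :=
    f.hasCompactSupport.comp_left (g := ((↑) : ℝ≥0 → ℝ)) NNReal.coe_zero
  obtain ⟨C, hC⟩ := h.exists_bound_of_continuous (NNReal.continuous_coe.comp f.continuous)
  refine ⟨C.toNNReal, fun x => ?_⟩
  rw [← NNReal.coe_le_coe]
  exact ((le_abs_self _).trans (hC x)).trans (Real.le_coe_toNNReal C)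

/-- Boundedness of `f` is essential here: an unbounded supremum in `ℝ≥0` is `0` by convention. -/
theorem nnnorm_le_dualVariation {f : C_c(Z, ℝ≥0)} {F : C₀(Z, H)} (hF : ∀ x, ‖F x‖₊ ≤ f x) :
    ‖L F‖₊ ≤ dualVariation L f := by
  obtain ⟨C, hC⟩ := exists_bound_of_compactlySupported f
  refine le_ciSup (f := fun F : {F : C₀(Z, H) // ∀ x, ‖F x‖₊ ≤ f x} => ‖L F‖₊) ⟨‖L‖₊ * C, ?_⟩
    ⟨F, hF⟩
  rintro _ ⟨⟨G, hG⟩, rfl⟩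
  refine (L.le_opNNNorm G).trans (mul_le_mul_of_nonneg_left ?_ zero_le)
  exact ZeroAtInftyContinuousMap.norm_le_of_forall C.2 fun x => (hG x).trans (hC x)

theorem dualVariation_le {f : C_c(Z, ℝ≥0)} {c : ℝ≥0}
    (h : ∀ F : C₀(Z, H), (∀ x, ‖F x‖₊ ≤ f x) → ‖L F‖₊ ≤ c) : dualVariation L f ≤ c :=
  ciSup_le' fun F => h F F.2

theorem dualVariation_le_opNorm {f : C_c(Z, ℝ≥0)} (hf : ∀ x, f x ≤ 1) :
    dualVariation L f ≤ ‖L‖₊ := by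
  refine dualVariation_le L fun F hF => ?_
  refine (L.le_opNNNorm F).trans (mul_le_of_le_one_right zero_le ?_)
  exact ZeroAtInftyContinuousMap.norm_le_of_forall zero_le_one fun x => (hF x).trans (hf x)

/-- For `≤`, a function `F` dominated by `f + g` is split into `f F / (f + g + δ)`, `g F / (f + g +
δ)` and a remainder of norm at most `δ`; the `δ` avoids division by zero. For `≥`, competitors for
`f` and `g` are multiplied by phases that make both values of `L` nonnegative, so that their sum is
a competitor for `f + g`. -/
theorem dualVariation_add (f g : C_c(Z, ℝ≥0)) :
    dualVariation L (f + g) = dualVariation L f + dualVariation L g := by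
  refine le_antisymm (dualVariation_le L fun F hF => ?_) ?_
  · refine le_of_forall_pos_le_add fun ε hε => ?_
    obtain ⟨δ, hδ, hδε⟩ : ∃ δ : ℝ, 0 < δ ∧ ‖L‖ * δ ≤ ε := by
      refine ⟨ε / (‖L‖ + 1), by positivity, ?_⟩
      rw [mul_div_assoc', div_le_iff₀ (by positivity), mul_comm (ε : ℝ)]
      gcongr
      linarith
    have hd : ∀ x, 0 < (f x : ℝ) + g x + δ := fun x => by positivity
    have hfc : Continuous fun x => (f x : ℝ) := NNReal.continuous_coe.comp f.continuous
    have hgc : Continuous fun x => (g x : ℝ) := NNReal.continuous_coe.comp g.continuous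
    have hF' : ∀ x, ‖F x‖ ≤ f x + g x := fun x => by exact_mod_cast hF x
    have part : ∀ a : C_c(Z, ℝ≥0), (∀ x, (a x : ℝ) ≤ f x + g x) → ∃ G : C₀(Z, H),
        (∀ x, G x = ((a x : ℝ) / (f x + g x + δ)) • F x) ∧ ∀ x, ‖G x‖₊ ≤ a x := by
      intro a ha
      have hac : Continuous fun x => (a x : ℝ) := NNReal.continuous_coe.comp a.continuous
      obtain ⟨G, hG⟩ := F.exists_smul (φ := fun x => (a x : ℝ) / (f x + g x + δ))
        (hac.div ((hfc.add hgc).add continuous_const) fun x => (hd x).ne') fun x => by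
          rw [abs_of_nonneg (by positivity), div_le_one (hd x)]
          linarith [ha x]
      refine ⟨G, hG, fun x => ?_⟩
      rw [← NNReal.coe_le_coe, coe_nnnorm, hG, norm_smul, Real.norm_of_nonneg (by positivity),
        div_mul_eq_mul_div, div_le_iff₀ (hd x)]
      gcongr
      linarith [hF' x]
    obtain ⟨F₁, h1, h1'⟩ := part f fun x => le_add_of_nonneg_right (g x).2
    obtain ⟨F₂, h2, h2'⟩ := part g fun x => le_add_of_nonneg_left (f x).2
    have hr : ‖F - F₁ - F₂‖ ≤ δ := by
      refine ZeroAtInftyContinuousMap.norm_le_of_forall hδ.le fun x => ?_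
      have e : (F - F₁ - F₂) x = (δ / (f x + g x + δ)) • F x := by
        simp only [ZeroAtInftyContinuousMap.sub_apply, h1, h2]
        nth_rewrite 1 [← one_smul ℝ (F x)]
        rw [← sub_smul, ← sub_smul]
        congr 1
        have := (hd x).ne'
        field_simp
        ring
      rw [e, norm_smul, Real.norm_of_nonneg (by positivity), div_mul_eq_mul_div,
        div_le_iff₀ (hd x)]
      gcongr
      linarith [hF' x]
    have e : L F = L F₁ + L F₂ + L (F - F₁ - F₂) := by simp
    rw [e, ← NNReal.coe_le_coe]
    push_cast
    refine (norm_add₃_le ..).trans ?_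
    have l1 : ‖L F₁‖ ≤ dualVariation L f := nnnorm_le_dualVariation L h1'
    have l2 : ‖L F₂‖ ≤ dualVariation L g := nnnorm_le_dualVariation L h2'
    have l3 : ‖L (F - F₁ - F₂)‖ ≤ ε :=
      (L.le_opNorm _).trans ((mul_le_mul_of_nonneg_left hr (norm_nonneg _)).trans hδε)
    linarith
  · have key : ∀ F G : C₀(Z, H), (∀ x, ‖F x‖₊ ≤ f x) → (∀ x, ‖G x‖₊ ≤ g x) →
        ‖L F‖₊ + ‖L G‖₊ ≤ dualVariation L (f + g) := by
      intro F G hF hG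
      obtain ⟨a, ha, ha'⟩ := Complex.exists_norm_eq_mul_self (L F)
      obtain ⟨b, hb, hb'⟩ := Complex.exists_norm_eq_mul_self (L G)
      have h := nnnorm_le_dualVariation L (f := f + g) (F := a • F + b • G) fun x => by
        refine (nnnorm_add_le _ _).trans (add_le_add ?_ ?_)
        · have : ‖a‖₊ = 1 := NNReal.eq ha
          simpa [nnnorm_smul, this] using hF x
        · have : ‖b‖₊ = 1 := NNReal.eq hb
          simpa [nnnorm_smul, this] using hG x
      refine le_trans (le_of_eq ?_) h
      rw [map_add, map_smul, map_smul, smul_eq_mul, smul_eq_mul, ← ha', ← hb', ← NNReal.coe_inj]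
      push_cast
      rw [← Complex.ofReal_add, Complex.norm_real, Real.norm_of_nonneg (by positivity)]
    -- Take the supremum over `G` first and then over `F`, moving the other term across by truncated
    -- subtraction.
    have hz : ∀ F : C₀(Z, H), (∀ x, ‖F x‖₊ ≤ f x) →
        dualVariation L g ≤ dualVariation L (f + g) - ‖L F‖₊ := fun F hF =>
      dualVariation_le L fun G hG => le_tsub_of_add_le_left (key F G hF hG)
    have hle : dualVariation L g ≤ dualVariation L (f + g) :=
      dualVariation_le L fun G hG => by simpa using key 0 G (by simp) hG
    have : dualVariation L f ≤ dualVariation L (f + g) - dualVariation L g := by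
      refine dualVariation_le L fun F hF => le_tsub_of_add_le_left ?_
      have hF' : ‖L F‖₊ ≤ dualVariation L (f + g) := by simpa using key F 0 hF (by simp)
      exact (le_tsub_iff_right hF').1 (hz F hF)
    exact (le_tsub_iff_right hle).1 this

/-- For `c ≠ 0` one inequality suffices: applied to `c⁻¹` and `c • f`, it yields the other. -/
theorem dualVariation_smul (c : ℝ≥0) (f : C_c(Z, ℝ≥0)) :
    dualVariation L (c • f) = c * dualVariation L f := by
  have hle : ∀ (c : ℝ≥0) (f : C_c(Z, ℝ≥0)), c ≠ 0 →
      dualVariation L (c • f) ≤ c * dualVariation L f := by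
    intro c f hc
    refine dualVariation_le L fun F hF => ?_
    have h := nnnorm_le_dualVariation L (f := f) (F := (((c⁻¹ : ℝ≥0) : ℝ) : ℂ) • F) fun x => by
      have := hF x
      simp only [ZeroAtInftyContinuousMap.smul_apply, nnnorm_smul, Complex.nnnorm_real,
        NNReal.nnnorm_eq]
      rw [inv_mul_le_iff₀ (pos_iff_ne_zero.2 hc)]
      simpa using this
    rw [map_smul, nnnorm_smul, Complex.nnnorm_real, NNReal.nnnorm_eq,
      inv_mul_le_iff₀ (pos_iff_ne_zero.2 hc)] at h
    exact h
  rcases eq_or_ne c 0 with rfl | hc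
  · refine le_antisymm (dualVariation_le L fun F hF => ?_) (by simp)
    have : F = 0 := by
      ext x
      simpa using hF x
    simp [this]
  · refine le_antisymm (hle c f hc) ?_
    have := hle c⁻¹ (c • f) (inv_ne_zero hc)
    rw [smul_smul, inv_mul_cancel₀ hc, one_smul] at this
    rwa [← le_inv_mul_iff₀ (pos_iff_ne_zero.2 hc)]

/-- The total variation of a functional on `C₀(Z, H)`, as a positive functional. -/
noncomputable def dualVariationLinear : C_c(Z, ℝ≥0) →ₗ[ℝ≥0] ℝ≥0 where
  toFun := dualVariation L
  map_add' := dualVariation_add L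
  map_smul' c f := dualVariation_smul L c f

variable [T2Space Z] [LocallyCompactSpace Z] [MeasurableSpace Z] [BorelSpace Z]

/-- By inner regularity it suffices to bound compact sets, and a cutoff function between `0` and `1`
dominates the indicator of such a set. -/
theorem rieszMeasure_dualVariationLinear_univ_le :
    NNRealRMK.rieszMeasure (dualVariationLinear L) Set.univ ≤ ‖L‖₊ := by
  rw [isOpen_univ.measure_eq_iSup_isCompact]
  refine iSup₂_le fun C _ => iSup_le fun hC => ?_
  obtain ⟨φ, h1, -, hs, h01⟩ := exists_continuous_one_zero_of_isCompact hC isClosed_empty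
    (Set.disjoint_empty C)
  let f : C_c(Z, ℝ≥0) := ⟨⟨fun x => (φ x).toNNReal, by fun_prop⟩,
    hs.comp_left (g := Real.toNNReal) (by simp)⟩
  have hf : ∀ x, f x ≤ 1 := fun x => Real.toNNReal_le_one.2 (h01 x).2
  calc NNRealRMK.rieszMeasure (dualVariationLinear L) C
      ≤ ∫⁻ x, f x ∂NNRealRMK.rieszMeasure (dualVariationLinear L) := by
        rw [← lintegral_indicator_one hC.measurableSet]
        refine lintegral_mono fun x => ?_
        by_cases hx : x ∈ C
        · have : f x = 1 := by simp [f, h1 hx]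
          simp [hx, this]
        · simp [hx]
    _ = dualVariationLinear L f := NNRealRMK.lintegral_rieszMeasure _ f
    _ ≤ ‖L‖₊ := by exact_mod_cast dualVariation_le_opNorm L hf

instance : IsFiniteMeasure (NNRealRMK.rieszMeasure (dualVariationLinear L)) :=
  ⟨(rieszMeasure_dualVariationLinear_univ_le L).trans_lt ENNReal.coe_lt_top⟩


/-- The norm of `F` need not have compact support, so `F` is shrunk to `G` with `‖G‖ ≤ max ‖F‖ ε -
ε`. This majorant is compactly supported, hence an admissible argument of the variation, and `‖F -
G‖ ≤ ε`. -/
theorem norm_le_integral_dualVariation (F : C₀(Z, H)) :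
    ‖L F‖ ≤ ∫ x, ‖F x‖ ∂NNRealRMK.rieszMeasure (dualVariationLinear L) := by
  refine le_of_forall_pos_le_add fun ε' hε' => ?_
  obtain ⟨ε, hε, hεε⟩ : ∃ ε : ℝ, 0 < ε ∧ ‖L‖ * ε ≤ ε' := by
    refine ⟨ε' / (‖L‖ + 1), by positivity, ?_⟩
    rw [mul_div_assoc', div_le_iff₀ (by positivity), mul_comm ε']
    gcongr
    linarith
  have hpos : ∀ x, 0 < max ‖F x‖ ε := fun x => lt_max_of_lt_right hε
  have hc : Continuous fun x => ‖F x‖ := F.continuous.norm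
  obtain ⟨G, hG⟩ := F.exists_smul (φ := fun x => (max ‖F x‖ ε - ε) / max ‖F x‖ ε)
    (((hc.max continuous_const).sub continuous_const).div (hc.max continuous_const)
      fun x => (hpos x).ne') fun x => by
      have : ε ≤ max ‖F x‖ ε := le_max_right _ _
      rw [abs_of_nonneg (div_nonneg (by linarith) (hpos x).le), div_le_one (hpos x)]
      linarith
  have hGn : ∀ x, ‖G x‖ ≤ max ‖F x‖ ε - ε := fun x => by
    have h1 : ε ≤ max ‖F x‖ ε := le_max_right _ _
    have h2 : ‖F x‖ ≤ max ‖F x‖ ε := le_max_left _ _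
    rw [hG, norm_smul, Real.norm_of_nonneg (div_nonneg (by linarith) (hpos x).le),
      div_mul_eq_mul_div, div_le_iff₀ (hpos x)]
    exact mul_le_mul_of_nonneg_left h2 (by linarith)
  have hFG : ‖F - G‖ ≤ ε := by
    refine ZeroAtInftyContinuousMap.norm_le_of_forall hε.le fun x => ?_
    have h2 : ‖F x‖ ≤ max ‖F x‖ ε := le_max_left _ _
    have e : (F - G) x = (ε / max ‖F x‖ ε) • F x := by
      rw [ZeroAtInftyContinuousMap.sub_apply, hG]
      nth_rewrite 1 [← one_smul ℝ (F x)]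
      rw [← sub_smul]
      congr 1
      have := (hpos x).ne'
      field_simp
      ring
    rw [e, norm_smul, Real.norm_of_nonneg (div_nonneg hε.le (hpos x).le),
      div_mul_eq_mul_div, div_le_iff₀ (hpos x)]
    exact mul_le_mul_of_nonneg_left h2 hε.le
  let g : C_c(Z, ℝ≥0) := ⟨⟨fun x => (max ‖F x‖ ε - ε).toNNReal, by fun_prop⟩, by
    have h0 := tendsto_zero_iff_norm_tendsto_zero.1 F.zero_at_infty'
    obtain ⟨C, hC, hCs⟩ := mem_cocompact.1 (h0.eventually_lt_const hε)
    refine HasCompactSupport.intro hC fun x hx => ?_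
    have : ‖F x‖ < ε := hCs hx
    simp [max_eq_right this.le]⟩
  have hg : ∀ x, (g x : ℝ) = max ‖F x‖ ε - ε := fun x =>
    Real.coe_toNNReal _ (by linarith [le_max_right ‖F x‖ ε])
  have h1 : ‖L G‖ ≤ dualVariation L g := nnnorm_le_dualVariation L fun x => by
    rw [← NNReal.coe_le_coe, hg]
    exact hGn x
  have h2 : (dualVariation L g : ℝ) = ∫ x, (g x : ℝ) ∂NNRealRMK.rieszMeasure
      (dualVariationLinear L) := (NNRealRMK.integral_rieszMeasure (dualVariationLinear L) g).symm
  have hFi : Integrable (fun x => ‖F x‖) (NNRealRMK.rieszMeasure (dualVariationLinear L)) :=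
    Integrable.of_bound hc.aestronglyMeasurable ‖F‖
      (Eventually.of_forall fun x => by simpa using F.norm_apply_le x)
  have h3 : ∫ x, (g x : ℝ) ∂NNRealRMK.rieszMeasure (dualVariationLinear L) ≤
      ∫ x, ‖F x‖ ∂NNRealRMK.rieszMeasure (dualVariationLinear L) := by
    refine integral_mono_of_nonneg (Eventually.of_forall fun x => (g x).2) hFi
      (Eventually.of_forall fun x => ?_)
    simp only [hg, tsub_le_iff_right]
    exact max_le (by linarith) (by linarith [norm_nonneg (F x)])
  have e : L F = L G + L (F - G) := by simp
  calc ‖L F‖ ≤ ‖L G‖ + ‖L (F - G)‖ := by rw [e]; exact norm_add_le _ _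
    _ ≤ _ := add_le_add ((h1.trans h2.le).trans h3)
      ((L.le_opNorm _).trans ((mul_le_mul_of_nonneg_left hFG (norm_nonneg _)).trans hεε))

/-- A functional on `C₀(Z, H)` that is bounded by an `L¹` norm extends to `L¹`. -/
theorem exists_extension_L1 [SecondCountableTopology Z] {μ : Measure Z}
    [IsFiniteMeasure μ]
    [μ.Regular] (hL : ∀ F : C₀(Z, H), ‖L F‖ ≤ ∫ x, ‖F x‖ ∂μ) :
    ∃ Λ : Lp H 1 μ →L[ℂ] ℂ, (∀ u, ‖Λ u‖ ≤ ‖u‖) ∧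
      ∀ (F : C₀(Z, H)) (hF : Integrable F μ), Λ (hF.toL1 F) = L F := by
  have hi : ∀ F : C₀(Z, H), Integrable F μ := fun F =>
    Integrable.of_bound F.continuous.aestronglyMeasurable ‖F‖
      (Eventually.of_forall F.norm_apply_le)
  let e : C₀(Z, H) →ₗ[ℂ] Lp H 1 μ :=
    { toFun := fun F => (hi F).toL1 F
      map_add' := fun F G => Integrable.toL1_add F G (hi F) (hi G)
      map_smul' := fun c F => Integrable.toL1_smul' F (hi F) c }
  have hb : ∀ F : C₀(Z, H), ‖L F‖ ≤ 1 * ‖e F‖ := fun F => by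
    rw [one_mul]
    refine (hL F).trans (le_of_eq ?_)
    exact (L1.norm_of_fun_eq_integral_norm (hi F)).symm
  -- Compactly supported continuous functions are dense in `L¹` of a regular measure.
  have hd : DenseRange e := by
    refine Metric.dense_iff.2 fun u r hr => ?_
    have hu : Integrable u μ := L1.integrable_coeFn u
    obtain ⟨g, hgs, hgε, hgc, hgi⟩ := hu.exists_hasCompactSupport_integral_sub_le (half_pos hr)
    let G : C₀(Z, H) := ⟨⟨g, hgc⟩, hgs.is_zero_at_infty⟩
    refine ⟨e G, ?_, ⟨G, rfl⟩⟩
    have e1 : u - e G = (hu.sub (hi G)).toL1 (fun z => u z - G z) := by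
      conv_lhs => rw [← Integrable.toL1_coeFn u hu]
      exact (Integrable.toL1_sub u G hu (hi G)).symm
    rw [Metric.mem_ball, dist_comm, dist_eq_norm, e1, L1.norm_of_fun_eq_integral_norm]
    exact lt_of_le_of_lt hgε (by linarith)
  refine ⟨L.toLinearMap.extendOfNorm e, fun u => ?_, fun F hF => ?_⟩
  · simpa using LinearMap.norm_extendOfNorm_apply_le hd 1 hb u
  · exact LinearMap.extendOfNorm_eq hd ⟨1, hb⟩ F

omit [TopologicalSpace Z] [T2Space Z] [LocallyCompactSpace Z] [BorelSpace Z] in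
/-- A functional on `L¹(μ, H)` is given by a vector measure. -/
theorem exists_vectorMeasure_of_L1 [CompleteSpace H] {μ : Measure Z} [IsFiniteMeasure μ]
    {Λ : Lp H 1 μ →L[ℂ] ℂ} (hΛ : ∀ u, ‖Λ u‖ ≤ ‖u‖) :
    ∃ η : VectorMeasure Z H, η.variation ≤ μ ∧
      ∀ (f : Z → H) (C : ℝ) (hf : Integrable f μ), StronglyMeasurable f → (∀ z, ‖f z‖ ≤ C) →
        bartleIntegral f η = Λ (hf.toL1 f) := by
  classical
  have hi : ∀ {s : Set Z} (_ : MeasurableSet s) (v : H), Integrable (s.indicator fun _ => v) μ :=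
    fun hs v => (integrable_const v).indicator hs
  have hn : ∀ {s : Set Z} (hs : MeasurableSet s) (v : H),
      ‖Λ ((hi hs v).toL1 _)‖ ≤ μ.real s * ‖v‖ := fun {s} hs v => by
    refine (hΛ _).trans (le_of_eq ?_)
    rw [L1.norm_of_fun_eq_integral_norm]
    simp_rw [norm_indicator_eq_indicator_norm]
    rw [integral_indicator_const _ hs, smul_eq_mul]
  -- Testing `Λ` on `v χ_s` gives a functional of `v` of norm at most `μ s`. Its Riesz vector is the
  -- value of the measure on `s`, and domination by `μ` upgrades finite to countable additivity.
  let ℓ : ∀ s : Set Z, MeasurableSet s → H →L[ℂ] ℂ := fun s hs =>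
    LinearMap.mkContinuous
      { toFun := fun v => Λ ((hi hs v).toL1 _)
        map_add' := fun v w => by
          rw [← map_add, ← Integrable.toL1_add]
          congr 2
          exact Set.indicator_add s (fun _ => v) fun _ => w
        map_smul' := fun c v => by
          rw [RingHom.id_apply, ← map_smul, ← Integrable.toL1_smul']
          congr 2
          exact Set.indicator_const_smul s c fun _ => v } (μ.real s) (hn hs)
  let m : Set Z → H := fun s =>
    if hs : MeasurableSet s then (InnerProductSpace.toDual ℂ H).symm (ℓ s hs) else 0
  have hm : ∀ {s : Set Z} (hs : MeasurableSet s) (v : H),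
      inner ℂ (m s) v = Λ ((hi hs v).toL1 _) := fun hs v => by
    simp only [m, dif_pos hs, InnerProductSpace.toDual_symm_apply]
    rfl
  have hmle : ∀ s, ‖m s‖ₑ ≤ μ s := fun s => by
    by_cases hs : MeasurableSet s
    · rw [← ofReal_norm, ← ofReal_measureReal]
      refine ENNReal.ofReal_le_ofReal ?_
      simp only [m, dif_pos hs, LinearIsometryEquiv.norm_map]
      exact LinearMap.mkContinuous_norm_le _ measureReal_nonneg _
    · simp [m, dif_neg hs]
  let η : VectorMeasure Z H := VectorMeasure.of_additive_of_le_measure m hmle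
    (fun s t hs ht hst => ext_inner_right ℂ fun v => by
      rw [inner_add_left, hm (hs.union ht), hm hs, hm ht, ← map_add, ← Integrable.toL1_add]
      congr 2
      exact Set.indicator_union_of_disjoint hst _)
    (fun s hs => dif_neg hs)
  have hη : η.variation ≤ μ := VectorMeasure.variation_le_of_forall_enorm_le fun s _ => hmle s
  have : IsFiniteMeasure η.variation := isFiniteMeasure_of_le μ hη
  refine ⟨η, hη, fun f C hf hfm hC => ?_⟩
  refine bounded_stronglyMeasurable_induction
    (fun f => ∀ hf : Integrable f μ, bartleIntegral f η = Λ (hf.toL1 f)) ?_ ?_ ?_ hfm hC hf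
  · intro v s hs hf
    rw [bartleIntegral_indicator v hs]
    exact hm hs v
  · intro f g hf hg hfg
    have hi : ∀ (ν : Measure Z) [IsFiniteMeasure ν] (f : SimpleFunc Z H), Integrable f ν :=
      fun ν _ f => SimpleFunc.integrable_of_isFiniteMeasure f
    rw [bartleIntegral_add (hi _ f) (hi _ g), hf (hi μ f), hg (hi μ g), ← map_add,
      ← Integrable.toL1_add]
  · intro F f C hfm hC hl hP hf
    have hi : ∀ n, Integrable (F n) μ := fun n => SimpleFunc.integrable_of_isFiniteMeasure (F n)
    refine tendsto_nhds_unique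
      (tendsto_bartleIntegral (η := η) (fun n => (F n).stronglyMeasurable) hC hl) ?_
    simp only [hP _ (hi _)]
    refine (Λ.continuous.tendsto _).comp ?_
    rw [tendsto_iff_norm_sub_tendsto_zero]
    have e : ∀ n, ‖(hi n).toL1 (F n) - hf.toL1 f‖ = ∫ z, ‖F n z - f z‖ ∂μ := fun n => by
      rw [← Integrable.toL1_sub, L1.norm_of_fun_eq_integral_norm]
      rfl
    simp only [e]
    have h0 : (0 : ℝ) = ∫ _, (0 : ℝ) ∂μ := by simp
    rw [h0]
    have hCf : ∀ z, ‖f z‖ ≤ C := fun z => le_of_tendsto' (hl z).norm fun n => hC n z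
    refine tendsto_integral_of_dominated_convergence (fun _ => C + C)
      (fun n => ((F n).stronglyMeasurable.sub hfm).norm.aestronglyMeasurable)
      (integrable_const _) (fun n => Eventually.of_forall fun z => ?_)
      (Eventually.of_forall fun z => ?_)
    · rw [norm_norm]
      exact (norm_sub_le _ _).trans (add_le_add (hC n z) (hCf z))
    · simpa using (tendsto_iff_norm_sub_tendsto_zero.1 (hl z))

/-- The Riesz representation theorem for `C₀(Z, H)`. -/
theorem exists_isRadon_bartleIntegral_eq [CompleteSpace H] [SecondCountableTopology Z] :
    ∃ η : VectorMeasure Z H, IsRadon η ∧ ∀ F : C₀(Z, H), bartleIntegral F η = L F := by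
  obtain ⟨Λ, hΛ, hΛL⟩ := exists_extension_L1 L (norm_le_integral_dualVariation L)
  obtain ⟨η, hη, h⟩ := exists_vectorMeasure_of_L1 hΛ
  have : IsFiniteMeasure η.variation := isFiniteMeasure_of_le _ hη
  -- Regularity is automatic for a finite Borel measure on such a space.
  refine ⟨η, ⟨this, inferInstance⟩, fun F => ?_⟩
  have hF : Integrable F (NNRealRMK.rieszMeasure (dualVariationLinear L)) :=
    integrable_of_bounded F.continuous.stronglyMeasurable F.norm_apply_le
  rw [h F ‖F‖ hF F.continuous.stronglyMeasurable F.norm_apply_le, hΛL]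

end Riesz

/-! ### Derivatives of kernels and potentials -/

section KernelDerivatives

variable {H : Type*} [NormedAddCommGroup H] [InnerProductSpace ℂ H] [CompleteSpace H]
  {m q : ℕ} {U : Set (EuclideanSpace ℝ (Fin m))}

omit [CompleteSpace H] in
theorem strongDeriv_eq {α : Fin m → ℕ} {L : U → H →L[ℂ] H} {x : U} {T : H →L[ℂ] H}
    (hT : ∀ v, T v = dAlpha α (fun x' => L x' v) x) : strongDeriv α L x = T := by
  have h : ∃ T : H →L[ℂ] H, ∀ v, T v = dAlpha α (fun x' => L x' v) x := ⟨T, hT⟩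
  rw [strongDeriv, dif_pos h]
  exact ContinuousLinearMap.ext fun v => (h.choose_spec v).trans (hT v).symm

omit [CompleteSpace H] in
theorem weakDeriv_eq {β : Fin m → ℕ} {L : U → H →L[ℂ] H} {y : U} {T : H →L[ℂ] H}
    (hT : ∀ u v, inner ℂ u (T v) = dAlpha β (fun y' => inner ℂ u (L y' v)) y) :
    weakDeriv β L y = T := by
  have h : ∃ T : H →L[ℂ] H, ∀ u v, inner ℂ u (T v) = dAlpha β (fun y' => inner ℂ u (L y' v)) y :=
    ⟨T, hT⟩
  rw [weakDeriv, dif_pos h]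
  exact ContinuousLinearMap.ext fun v =>
    ext_inner_left ℂ fun u => (h.choose_spec u v).trans (hT u v).symm

variable {W : Type*} [NormedAddCommGroup W] [InnerProductSpace ℂ W] [CompleteSpace W]
  {E : U → W →L[ℂ] H} {K : U → U → H →L[ℂ] H}
  {D : MultiIndex m q → U → W →L[ℂ] H}

/-- As a function of `y`, the matrix coefficient is a fixed real linear map applied to the `C^q`
function given by `(E x)* u`; derivatives in `y` therefore pass through. -/
theorem inner_kernel_eq (hK : ∀ x y, K x y = E x ∘L (E y).adjoint) (x y : U) (u v : H) :
    inner ℂ u (K x y v) = pairing H v (E y ((E x).adjoint u)) := by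
  rw [pairing_apply, hK, ContinuousLinearMap.comp_apply,
    ← ContinuousLinearMap.adjoint_inner_left, ContinuousLinearMap.adjoint_inner_right]

theorem inner_deriv_kernel (hU : IsOpen U) (hE : ∀ f, IsCq q fun x => E x f)
    (hK : ∀ x y, K x y = E x ∘L (E y).adjoint)
    (hD : ∀ α x f, D α x f = dAlpha α.1 (fun x => E x f) x) (β : MultiIndex m q) (x y : U)
    (u v : H) :
    inner ℂ u ((E x ∘L (D β y).adjoint) v) =
      dAlpha β.1 (fun y' => inner ℂ u (K x y' v)) y := by
  simp only [inner_kernel_eq hK]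
  rw [(hE _).dAlpha_clm_comp hU, ← hD, pairing_apply, ContinuousLinearMap.comp_apply,
    ← ContinuousLinearMap.adjoint_inner_left, ContinuousLinearMap.adjoint_inner_right]

theorem deriv₂_eq (hU : IsOpen U) (hE : ∀ f, IsCq q fun x => E x f)
    (hK : ∀ x y, K x y = E x ∘L (E y).adjoint)
    (hD : ∀ α x f, D α x f = dAlpha α.1 (fun x => E x f) x) (β : MultiIndex m q) (x y : U) :
    deriv₂ K β.1 x y = E x ∘L (D β y).adjoint :=
  weakDeriv_eq (inner_deriv_kernel hU hE hK hD β x y)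

theorem deriv₁_eq (hK : ∀ x y, K x y = E x ∘L (E y).adjoint)
    (hD : ∀ α x f, D α x f = dAlpha α.1 (fun x => E x f) x) (α : MultiIndex m q) (x y : U) :
    deriv₁ K α.1 x y = D α x ∘L (E y).adjoint :=
  strongDeriv_eq fun v => by simp only [hK, ContinuousLinearMap.comp_apply, hD]

theorem deriv₁₂_eq (hU : IsOpen U) (hE : ∀ f, IsCq q fun x => E x f)
    (hK : ∀ x y, K x y = E x ∘L (E y).adjoint)
    (hD : ∀ α x f, D α x f = dAlpha α.1 (fun x => E x f) x) (α β : MultiIndex m q) (x y : U) :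
    deriv₁₂ K α.1 β.1 x y = D α x ∘L (D β y).adjoint :=
  strongDeriv_eq fun v => by
    simp only [deriv₂_eq hU hE hK hD, ContinuousLinearMap.comp_apply, hD]

theorem hasKernelDerivatives (hU : IsOpen U) (hE : ∀ f, IsCq q fun x => E x f)
    (hK : ∀ x y, K x y = E x ∘L (E y).adjoint)
    (hD : ∀ α x f, D α x f = dAlpha α.1 (fun x => E x f) x) {C : (U → H) → Prop}
    (hC : ∀ f, C fun x => E x f) : HasKernelDerivatives q K C := by
  have h0 : ∀ x, D (zeroIndex m q) x = E x := fun x => by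
    ext f
    rw [hD, dAlpha_zeroIndex]
  refine ⟨fun x u v => ?_, fun β x y u v => ?_, fun β y v => ?_, fun α β x y v => ?_,
    fun α x y => ?_⟩
  · simp only [inner_kernel_eq hK]
    exact (hE _).clm_comp _
  · rw [deriv₂_eq hU hE hK hD, inner_deriv_kernel hU hE hK hD]
  · simp only [deriv₂_eq hU hE hK hD]
    -- The function is the one given by the vector `(D β y)* v` of `W`, so it has every property
    -- common to all of them.
    exact hC ((D β y).adjoint v)
  · simp only [deriv₁₂_eq hU hE hK hD, deriv₂_eq hU hE hK hD, ContinuousLinearMap.comp_apply, hD]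
  · rw [deriv₁_eq hK hD, ← h0]
    exact deriv₁₂_eq hU hE hK hD α (zeroIndex m q) x y

variable {Z : Type*} [MeasurableSpace Z] {ι : Z → U} {η : MultiIndex m q → VectorMeasure Z H}

omit [CompleteSpace H] in
/-- The functional `f ↦ ∫ ⟨T_z f, dη(z)⟩`, for a bounded family of operators `T_z`, is represented
by a vector. -/
theorem exists_inner_eq_bartleIntegral {η : VectorMeasure Z H} [IsFiniteMeasure η.variation]
    {T : Z → W →L[ℂ] H} (hT : ∀ f, StronglyMeasurable fun z => T z f) {C : ℝ}
    (hC : ∀ z, ‖T z‖ ≤ C) :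
    ∃ k : W, ∀ f, inner ℂ k f = bartleIntegral (fun z => T z f) η := by
  have hb : ∀ f z, ‖T z f‖ ≤ C * ‖f‖ := fun f z => (T z).le_of_opNorm_le (hC z) f
  have hi : ∀ f, Integrable (fun z => T z f) η.variation := fun f =>
    integrable_of_bounded (hT f) (hb f)
  let Φ : W →L[ℂ] ℂ := LinearMap.mkContinuous
    { toFun := fun f => bartleIntegral (fun z => T z f) η
      map_add' := fun f g => by
        rw [← bartleIntegral_add (hi f) (hi g)]
        congr 1
        funext z
        simp
      map_smul' := fun c f => by
        simp only [map_smul]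
        exact bartleIntegral_smul c (hT f) (hb f) }
    (C * η.variation.real Set.univ) fun f => by
      refine (norm_bartleIntegral_le (hb f)).trans (le_of_eq ?_)
      ring
  exact ⟨(InnerProductSpace.toDual ℂ W).symm Φ, fun f => by
    rw [InnerProductSpace.toDual_symm_apply]; rfl⟩

theorem exists_potential (hU : IsOpen U) (hE : ∀ f, IsCq q fun x => E x f)
    (hK : ∀ x y, K x y = E x ∘L (E y).adjoint)
    (hD : ∀ α x f, D α x f = dAlpha α.1 (fun x => E x f) x)
    (hη : ∀ α, IsFiniteMeasure (η α).variation)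
    (hm : ∀ α f, StronglyMeasurable fun z => D α (ι z) f) {C : ℝ}
    (hC : ∀ α z, ‖D α (ι z)‖ ≤ C) :
    ∃ k : W, (∀ f, inner ℂ k f = ∑ α, bartleIntegral (fun z => D α (ι z) f) (η α)) ∧
      ((∀ (α : MultiIndex m q) (y : U),
        WeakBochnerIntegrable (fun x => deriv₁ K α.1 (ι x) y) (η α)) ∧
        (fun x => E x k) = kernelPotential K ι η) ∧
      DerivativeFormula K ι η ∧ DoubleIntegralFormula K ι η (inner ℂ k k) ∧
      DensityFormula K ι η (inner ℂ k k) := by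
  have hb : ∀ α f z, ‖D α (ι z) f‖ ≤ C * ‖f‖ := fun α f z =>
    (D α (ι z)).le_of_opNorm_le (hC α z) f
  have hi : ∀ α f, Integrable (fun z => D α (ι z) f) (η α).variation := fun α f =>
    integrable_of_bounded (hm α f) (hb α f)
  choose κ hκ using fun α => exists_inner_eq_bartleIntegral (η := η α) (hm α) (hC α)
  -- For every bounded `S`, the vector `S (κ α)` is the weak integral of `D α ∘ S*`. The choices `S
  -- = E y` and `S = D β y` give the potential and its derivatives.
  have w : ∀ (α : MultiIndex m q) (S : W →L[ℂ] H) (v : H), inner ℂ (S (κ α)) v =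
      bartleIntegral (fun z => (D α (ι z) ∘L S.adjoint) v) (η α) := fun α S v => by
    rw [← ContinuousLinearMap.adjoint_inner_right, hκ]
    rfl
  have d1 : ∀ (α : MultiIndex m q) (y : U),
      (fun x => deriv₁ K α.1 (ι x) y) = fun z => D α (ι z) ∘L (E y).adjoint := fun α y =>
    funext fun z => deriv₁_eq hK hD α (ι z) y
  have d12 : ∀ (α β : MultiIndex m q) (y : U),
      (fun x => deriv₁₂ K α.1 β.1 (ι x) y) = fun z => D α (ι z) ∘L (D β y).adjoint :=
    fun α β y => funext fun z => deriv₁₂_eq hU hE hK hD α β (ι z) y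
  have t : ∀ (α β : MultiIndex m q) (y : U), potentialTerm K ι η α β y = D β y (κ α) :=
    fun α β y => by
      rw [potentialTerm, d12]
      exact weakBochnerIntegral_eq (w α _)
  have hpot : (fun x => E x (∑ α, κ α)) = kernelPotential K ι η := by
    funext y
    rw [kernelPotential, map_sum]
    refine Finset.sum_congr rfl fun α _ => ?_
    rw [d1]
    exact (weakBochnerIntegral_eq (w α _)).symm
  refine ⟨∑ α, κ α, fun f => ?_, ⟨fun α y => ?_, hpot⟩, fun β y => ⟨fun α => ?_, ?_⟩,
    ⟨fun α β => ?_, ?_⟩, fun μ h hμ hh hηh => ?_⟩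
  · rw [sum_inner]
    exact Finset.sum_congr rfl fun α _ => hκ α f
  · rw [d1]
    exact WeakBochnerIntegrable.of_inner (fun v => hi α _) (w α _)
  · rw [d12]
    exact WeakBochnerIntegrable.of_inner (fun v => hi α _) (w α _)
  · rw [← hpot, ← hD, map_sum]
    exact Finset.sum_congr rfl fun α _ => (t α β y).symm
  · simp only [t]
    exact hi β _
  · simp only [t, ← hκ]
    rw [sum_inner, Finset.sum_comm]
    exact Finset.sum_congr rfl fun β _ => inner_sum ..
  · have hin : ∀ α f, Integrable (fun z => inner ℂ (h α z) (D α (ι z) f)) μ := fun α f =>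
      ((hh α).norm.mul_const (C * ‖f‖)).mono'
        ((hh α).aestronglyMeasurable.inner (hm α f).aestronglyMeasurable)
        (Eventually.of_forall fun z => (norm_inner_le_norm _ _).trans
          (mul_le_mul_of_nonneg_left (hb α f z) (norm_nonneg _)))
    have hint : ∀ α f, ∫ z, inner ℂ (h α z) (D α (ι z) f) ∂μ = inner ℂ (κ α) f := fun α f => by
      rw [hκ, bartleIntegral_eq_integral_density (hh α) (hηh α) (hm α f) (hb α f)]
    -- The inner integral is the pairing of `κ α` with `(D β y)* h_β(y)`; moving the adjoint leaves
    -- a conjugate of the integrand that represents `κ β`.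
    have hinner : ∀ (α β : MultiIndex m q) (y : Z),
        ∫ x, inner ℂ (h α x) (deriv₁₂ K α.1 β.1 (ι x) (ι y) (h β y)) ∂μ =
          star (inner ℂ (h β y) (D β (ι y) (κ α))) := fun α β y => by
      simp only [deriv₁₂_eq hU hE hK hD, ContinuousLinearMap.comp_apply]
      rw [hint, ContinuousLinearMap.adjoint_inner_right]
      exact (inner_conj_symm _ _).symm
    refine ⟨fun α β y => ?_, fun α β => ?_, ?_⟩
    · simp only [deriv₁₂_eq hU hE hK hD, ContinuousLinearMap.comp_apply]
      exact hin α _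
    · simp only [hinner]
      exact (Complex.conjCLE.toContinuousLinearMap.integrable_comp (hin β (κ α)))
    · simp only [hinner]
      rw [sum_inner]
      refine Finset.sum_congr rfl fun α _ => ?_
      rw [inner_sum]
      refine Finset.sum_congr rfl fun β _ => ?_
      have : ∫ y, star (inner ℂ (h β y) (D β (ι y) (κ α))) ∂μ =
          star (∫ y, inner ℂ (h β y) (D β (ι y) (κ α)) ∂μ) := integral_conj
      rw [this, hint]
      exact (inner_conj_symm _ _).symm

end KernelDerivatives

/-! ### Approximation and annihilating measures -/

section Approximation

open scoped ZeroAtInfty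

variable {H : Type*} [NormedAddCommGroup H] [InnerProductSpace ℂ H] {J : Type*} [Fintype J]

/-- A vector which is annihilated by all functionals vanishing on the range of a linear map is a
limit of elements of this range. -/
theorem exists_norm_sub_lt_of_dual {X W : Type*} [NormedAddCommGroup X] [NormedSpace ℂ X]
    [AddCommGroup W] [Module ℂ W] (T : W →ₗ[ℂ] X) (g : X)
    (h : ∀ L : X →L[ℂ] ℂ, (∀ f, L (T f) = 0) → L g = 0) {ε : ℝ} (hε : 0 < ε) :
    ∃ f, ‖T f - g‖ < ε := by
  let S := LinearMap.range T
  -- Hahn–Banach in the quotient by the range. The range need not be closed, so the quotient norm is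
  -- only a seminorm; its vanishing at `g` says that `g` lies in the closure.
  have h0 : ‖(Submodule.Quotient.mk g : X ⧸ S)‖ = 0 := by
    by_contra hne
    obtain ⟨L, -, hL⟩ := exists_dual_vector ℂ (Submodule.Quotient.mk g : X ⧸ S) hne
    have h1 := h (L ∘L S.mkQL) fun f => by
      have : (Submodule.Quotient.mk (T f) : X ⧸ S) = 0 :=
        (Submodule.Quotient.mk_eq_zero S).2 ⟨f, rfl⟩
      change L (Submodule.Quotient.mk (T f)) = 0
      rw [this, map_zero]
    have h2 : L (Submodule.Quotient.mk g) = 0 := h1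
    rw [h2] at hL
    exact hne (RCLike.ofReal_eq_zero.1 hL.symm)
  obtain ⟨x, hx, hxε⟩ := Submodule.Quotient.norm_mk_lt (Submodule.Quotient.mk g : X ⧸ S) hε
  obtain ⟨f, hf⟩ := (Submodule.Quotient.eq S).1 hx
  refine ⟨-f, ?_⟩
  rw [map_neg, hf, h0, zero_add] at *
  simpa [norm_sub_rev] using hxε

variable {Z : Type*} [TopologicalSpace Z] [MeasurableSpace Z] [BorelSpace Z]

/-- Hahn–Banach in `J → C₀(Z, H)`: a functional on the finite product is a sum of functionals on the
factors, each of which is a Radon measure. -/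
theorem exists_approx_of_annihilators [CompleteSpace H] [T2Space Z] [LocallyCompactSpace Z]
    [SecondCountableTopology Z] {W : Type*} [NormedAddCommGroup W] [NormedSpace ℂ W]
    (T : J → Z → W →L[ℂ] H) (hTc : ∀ α f, Continuous fun z => T α z f)
    (hT0 : ∀ α f, Tendsto (fun z => T α z f) (cocompact Z) (𝓝 0)) (G : J → Z → H)
    (hGc : ∀ α, Continuous (G α)) (hG0 : ∀ α, Tendsto (G α) (cocompact Z) (𝓝 0))
    (h : ∀ η : J → VectorMeasure Z H, (∀ α, IsRadon (η α)) →
      (∀ f, ∑ α, bartleIntegral (fun z => T α z f) (η α) = 0) →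
      ∑ α, bartleIntegral (G α) (η α) = 0) {ε : ℝ} (hε : 0 < ε) :
    ∃ f, ∀ z, ∑ α, ‖T α z f - G α z‖ < ε := by
  classical
  let t : W →ₗ[ℂ] (J → C₀(Z, H)) :=
    { toFun := fun f α => ⟨⟨fun z => T α z f, hTc α f⟩, hT0 α f⟩
      map_add' := fun f g => by
        ext α z
        exact map_add (T α z) f g
      map_smul' := fun c f => by
        ext α z
        exact map_smul (T α z) c f }
  let g : J → C₀(Z, H) := fun α => ⟨⟨G α, hGc α⟩, hG0 α⟩
  obtain ⟨f, hf⟩ := exists_norm_sub_lt_of_dual t g (fun L hL => by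
    choose η hη hηL using fun α => exists_isRadon_bartleIntegral_eq
      (L ∘L ContinuousLinearMap.single ℂ (fun _ : J => C₀(Z, H)) α)
    have e : ∀ F : J → C₀(Z, H), ∑ α, bartleIntegral (F α) (η α) = L F := fun F => by
      simp only [hηL, ContinuousLinearMap.comp_apply]
      rw [← map_sum]
      congr 1
      exact Finset.univ_sum_single F
    rw [← e]
    exact h η hη fun f => (e (t f)).trans (hL f))
    -- The product norm bounds each of the `card J` summands; the extra `1` keeps the sum strictly
    -- below `ε` and covers empty `J`.
    (show 0 < ε / (Fintype.card J + 1) by positivity)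
  refine ⟨f, fun z => ?_⟩
  have hα : ∀ α, ‖T α z f - G α z‖ ≤ ε / (Fintype.card J + 1) := fun α =>
    ((t f - g) α).norm_apply_le z |>.trans ((norm_le_pi_norm (t f - g) α).trans hf.le)
  calc ∑ α, ‖T α z f - G α z‖ ≤ ∑ _α : J, ε / (Fintype.card J + 1) :=
        Finset.sum_le_sum fun α _ => hα α
    _ = Fintype.card J * (ε / (Fintype.card J + 1)) := by simp
    _ < ε := by
      rw [mul_div_assoc', div_lt_iff₀ (by positivity)]
      nlinarith

omit [TopologicalSpace Z] [BorelSpace Z] in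
-- The functional is continuous for uniform convergence, with constant the sum `M` of the total
-- variations.
theorem sum_bartleIntegral_eq_zero_of_approx {W : Type*} {η : J → VectorMeasure Z H}
    (hη : ∀ α, IsFiniteMeasure (η α).variation) {F : J → W → Z → H} {G : J → Z → H}
    (hF : ∀ α f, Integrable (F α f) (η α).variation)
    (hG : ∀ α, Integrable (G α) (η α).variation)
    (h0 : ∀ f, ∑ α, bartleIntegral (F α f) (η α) = 0)
    (h : ∀ ε > (0 : ℝ), ∃ f, ∀ z, ∑ α, ‖F α f z - G α z‖ < ε) :
    ∑ α, bartleIntegral (G α) (η α) = 0 := by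
  rw [← norm_eq_zero]
  refine le_antisymm (le_of_forall_pos_le_add fun δ hδ => ?_) (norm_nonneg _)
  set M := ∑ α, (η α).variation.real Set.univ
  have hM : 0 ≤ M := Finset.sum_nonneg fun α _ => measureReal_nonneg
  obtain ⟨f, hf⟩ := h (δ / (M + 1)) (by positivity)
  have e : ∑ α, bartleIntegral (G α) (η α) =
      -∑ α, bartleIntegral (fun z => F α f z - G α z) (η α) := by
    simp only [bartleIntegral_sub (hF _ f) (hG _), Finset.sum_sub_distrib, h0]
    ring
  rw [e, norm_neg, zero_add]
  calc ‖∑ α, bartleIntegral (fun z => F α f z - G α z) (η α)‖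
      ≤ ∑ α, δ / (M + 1) * (η α).variation.real Set.univ :=
        norm_sum_le_of_le _ fun α _ => norm_bartleIntegral_le fun z =>
          (Finset.single_le_sum (f := fun α => ‖F α f z - G α z‖)
            (fun _ _ => norm_nonneg _) (Finset.mem_univ α)).trans (hf z).le
    _ = δ / (M + 1) * M := by rw [Finset.mul_sum]
    _ ≤ δ := by
      rw [div_mul_eq_mul_div, div_le_iff₀ (by positivity)]
      nlinarith

end Approximation

/-! ### Potentials in the reproducing kernel Hilbert space -/

section KernelSpaces

variable {H : Type*} [NormedAddCommGroup H] [InnerProductSpace ℂ H] [CompleteSpace H]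

/-- Evaluation at a point, on the reproducing kernel Hilbert space. -/
noncomputable def evalKernelSpace {X : Type*} {K : X → X → H →L[ℂ] H}
    (hK : IsPositiveDefiniteKernel K) (x : X) : KernelSpace K hK →L[ℂ] H :=
  haveI : Fact (Matrix.of K).PosSemidef := ⟨hK.posSemidef⟩
  (RKHS.kerFun (RKHS.OfKernel (Matrix.of K)) x).adjoint

theorem evalKernelSpace_apply {X : Type*} {K : X → X → H →L[ℂ] H}
    (hK : IsPositiveDefiniteKernel K) (x : X) (f : KernelSpace K hK) :
    evalKernelSpace hK x f = f x :=
  have : Fact (Matrix.of K).PosSemidef := ⟨hK.posSemidef⟩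
  RKHS.adjoint_kerFun x f

theorem kernel_eq_eval_comp_adjoint {X : Type*} {K : X → X → H →L[ℂ] H}
    (hK : IsPositiveDefiniteKernel K) (x y : X) :
    K x y = evalKernelSpace hK x ∘L (evalKernelSpace hK y).adjoint := by
  have : Fact (Matrix.of K).PosSemidef := ⟨hK.posSemidef⟩
  have h := RKHS.kernel_apply (RKHS.OfKernel (Matrix.of K)) x y
  rw [RKHS.OfKernel.kernel_ofKernel] at h
  rw [evalKernelSpace, evalKernelSpace, ContinuousLinearMap.adjoint_adjoint]
  exact h

theorem kernelSpace_ext {X : Type*} {K : X → X → H →L[ℂ] H}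
    {hK : IsPositiveDefiniteKernel K} {f g : KernelSpace K hK} (h : (f : X → H) = g) : f = g :=
  DFunLike.coe_injective h

variable {m q : ℕ} {U : Set (EuclideanSpace ℝ (Fin m))} {K : U → U → H →L[ℂ] H}

theorem kernelSpace_hasKernelDerivatives (hU : IsOpen U) (hK : IsPositiveDefiniteKernel K)
    (hE : ∀ f : KernelSpace K hK, IsCq q (f : U → H)) {C : (U → H) → Prop}
    (hC : ∀ f : KernelSpace K hK, C f) : HasKernelDerivatives q K C := by
  have e : ∀ f : KernelSpace K hK, (fun x => evalKernelSpace hK x f) = (f : U → H) := fun f =>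
    funext fun x => evalKernelSpace_apply hK x f
  have hE' : ∀ f, IsCq q fun x => evalKernelSpace hK x f := fun f => by rw [e]; exact hE f
  obtain ⟨D, hD⟩ := exists_clm_dAlpha hU (evalKernelSpace hK) hE'
  exact hasKernelDerivatives hU hE' (kernel_eq_eval_comp_adjoint hK) hD
    fun f => by rw [e]; exact hC f

theorem exists_clm_dAlpha_kernelSpace (hU : IsOpen U) (hK : IsPositiveDefiniteKernel K)
    (hE : ∀ f : KernelSpace K hK, IsCq q (f : U → H)) :
    ∃ D : MultiIndex m q → U → KernelSpace K hK →L[ℂ] H,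
      ∀ α x f, D α x f = dAlpha α.1 (f : U → H) x := by
  have e : ∀ f : KernelSpace K hK, (fun x => evalKernelSpace hK x f) = (f : U → H) := fun f =>
    funext fun x => evalKernelSpace_apply hK x f
  obtain ⟨D, hD⟩ := exists_clm_dAlpha hU (evalKernelSpace hK) (q := q) fun f => by
    rw [e]; exact hE f
  exact ⟨D, fun α x f => by rw [hD, e]⟩

variable {Z : Type*} [TopologicalSpace Z] [MeasurableSpace Z] [OpensMeasurableSpace Z]
  [SecondCountableTopology Z] {ι : Z → U} {η : MultiIndex m q → VectorMeasure Z H}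

theorem exists_isPotential (hU : IsOpen U) (hK : IsPositiveDefiniteKernel K)
    (hE : ∀ f : KernelSpace K hK, IsCq q (f : U → H)) (hι : Continuous ι)
    (hb : ∀ (α : MultiIndex m q) (f : KernelSpace K hK), ∃ C, ∀ z, ‖dAlpha α.1 f (ι z)‖ ≤ C)
    (hη : ∀ α, IsFiniteMeasure (η α).variation) :
    ∃ k : KernelSpace K hK,
      (∀ f : KernelSpace K hK,
        inner ℂ k f = ∑ α, bartleIntegral (fun z => dAlpha α.1 f (ι z)) (η α)) ∧
      IsPotential K hK ι η k ∧ DerivativeFormula K ι η ∧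
      DoubleIntegralFormula K ι η (inner ℂ k k) ∧ DensityFormula K ι η (inner ℂ k k) := by
  have e : ∀ f : KernelSpace K hK, (fun x => evalKernelSpace hK x f) = (f : U → H) := fun f =>
    funext fun x => evalKernelSpace_apply hK x f
  have hE' : ∀ f, IsCq q fun x => evalKernelSpace hK x f := fun f => by rw [e]; exact hE f
  obtain ⟨D, hD⟩ := exists_clm_dAlpha_kernelSpace hU hK hE
  -- Second use of uniform boundedness, now over all `α` and all points of `Z` simultaneously.
  obtain ⟨C, hC⟩ := banach_steinhaus (g := fun p : MultiIndex m q × Z => D p.1 (ι p.2))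
    fun f => by
      choose C hC using fun α => hb α f
      refine ⟨∑ α, |C α|, fun p => ?_⟩
      rw [hD]
      exact ((hC p.1 p.2).trans (le_abs_self _)).trans
        (Finset.single_le_sum (f := fun α => |C α|) (fun _ _ => abs_nonneg _)
          (Finset.mem_univ p.1))
  obtain ⟨k, hk, ⟨hw, hp⟩, h⟩ := exists_potential hU hE' (kernel_eq_eval_comp_adjoint hK)
    (fun α x f => by rw [hD, e]) hη
    (fun α f => by
      simp only [hD]
      exact (((hE f).continuous_dAlpha hU α).comp hι).stronglyMeasurable)
    (fun α z => hC (α, z))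
  refine ⟨k, fun f => ?_, ⟨hw, ?_⟩, h⟩
  · simp only [hk, hD]
  · rw [← hp, e]

/-- The potential has positive norm if and only if the functional given by the measures does not
vanish on the Hilbert space of the kernel. -/
theorem exists_isPotential_pos_iff (hU : IsOpen U) (hK : IsPositiveDefiniteKernel K)
    (hE : ∀ f : KernelSpace K hK, IsCq q (f : U → H)) (hι : Continuous ι)
    (hb : ∀ (α : MultiIndex m q) (f : KernelSpace K hK), ∃ C, ∀ z, ‖dAlpha α.1 f (ι z)‖ ≤ C)
    (hη : ∀ α, IsFiniteMeasure (η α).variation) :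
    (∃ k : KernelSpace K hK, IsPotential K hK ι η k ∧ 0 < inner ℂ k k) ↔
      ∃ f : KernelSpace K hK,
        ∑ α, bartleIntegral (fun z => dAlpha α.1 f (ι z)) (η α) ≠ 0 := by
  obtain ⟨k, hk, hp, -⟩ := exists_isPotential hU hK hE hι hb hη
  constructor
  · rintro ⟨k', hp', hpos⟩
    obtain rfl : k' = k := kernelSpace_ext (hp'.2.trans hp.2.symm)
    exact ⟨k', by rw [← hk]; exact hpos.ne'⟩
  · rintro ⟨f, hf⟩
    refine ⟨k, hp, ?_⟩
    rw [← hk] at hf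
    have hk0 : k ≠ 0 := by
      rintro rfl
      exact hf (inner_zero_left f)
    rw [inner_self_eq_norm_sq_to_K]
    have : 0 < ‖k‖ ^ 2 := by positivity
    rw [← RCLike.ofReal_pow]
    exact RCLike.ofReal_pos.2 this

end KernelSpaces

/-! ### Universality and strict positivity -/

section Universality

variable {H : Type*} [NormedAddCommGroup H] [InnerProductSpace ℂ H] [CompleteSpace H]
  {m q : ℕ} {U : Set (EuclideanSpace ℝ (Fin m))} {K : U → U → H →L[ℂ] H}

omit [InnerProductSpace ℂ H] [CompleteSpace H] in
theorem exists_bound_of_tendsto_cocompact {Z : Type*} [TopologicalSpace Z] {F : Z → H}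
    (hF : Continuous F) (h0 : Tendsto F (cocompact Z) (𝓝 0)) : ∃ C, ∀ z, ‖F z‖ ≤ C :=
  ⟨_, ZeroAtInftyContinuousMap.norm_apply_le ⟨⟨F, hF⟩, h0⟩⟩

/-- Through `pos`, positivity becomes nonvanishing on the kernel space, and the claim is the duality
between density and annihilators. -/
theorem isC0qUniversal_iff (hU : IsOpen U) (hK : IsPositiveDefiniteKernel K)
    (hE : ∀ f : KernelSpace K hK, IsC0q q (f : U → H)) :
    IsC0qUniversal q K hK ↔
      ∀ η : MultiIndex m q → VectorMeasure U H, (∀ α, IsRadon (η α)) →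
        (∃ F : U → H, IsC0q q F ∧ ∑ α, bartleIntegral (dAlpha α.1 F) (η α) ≠ 0) →
        ∃ k : KernelSpace K hK, IsPotential K hK id η k ∧ 0 < inner ℂ k k := by
  have : LocallyCompactSpace U := hU.locallyCompactSpace
  have hb : ∀ {F : U → H}, IsC0q q F → ∀ α : MultiIndex m q, ∃ C, ∀ z, ‖dAlpha α.1 F z‖ ≤ C :=
    fun hF α => exists_bound_of_tendsto_cocompact (hF.2 α).1 (hF.2 α).2
  have hi : ∀ {F : U → H}, IsC0q q F → ∀ (α : MultiIndex m q) (μ : Measure U)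
      [IsFiniteMeasure μ], Integrable (dAlpha α.1 F) μ := fun hF α μ _ => by
    obtain ⟨C, hC⟩ := hb hF α
    exact integrable_of_bounded (hF.2 α).1.stronglyMeasurable hC
  have pos := fun (η : MultiIndex m q → VectorMeasure U H) (hη : ∀ α, IsRadon (η α)) =>
    exists_isPotential_pos_iff (η := η) (ι := id) hU hK (fun f => (hE f).1) continuous_id
      (fun α f => hb (hE f) α) fun α => (hη α).1
  constructor
  · rintro ⟨-, h⟩ η hη ⟨F, hF, hne⟩
    rw [pos η hη]
    by_contra! h0
    have hfin : ∀ α, IsFiniteMeasure (η α).variation := fun α => (hη α).1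
    exact hne (sum_bartleIntegral_eq_zero_of_approx hfin
      (F := fun α (f : KernelSpace K hK) => dAlpha α.1 f) (G := fun α => dAlpha α.1 F)
      (fun α f => hi (hE f) α _) (fun α => hi hF α _) h0 fun ε hε => h F hF ε hε)
  · refine fun h => ⟨hE, fun g hg ε hε => ?_⟩
    obtain ⟨D, hD⟩ := exists_clm_dAlpha_kernelSpace hU hK fun f => (hE f).1
    obtain ⟨f, hf⟩ := exists_approx_of_annihilators D
      (fun α f => by simp only [hD]; exact ((hE f).2 α).1)
      (fun α f => by simp only [hD]; exact ((hE f).2 α).2) (fun α => dAlpha α.1 g)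
      (fun α => (hg.2 α).1) (fun α => (hg.2 α).2) (fun η hη h0 => by
        by_contra hne
        obtain ⟨f, hf⟩ := (pos η hη).1 (h η hη ⟨g, hg, hne⟩)
        refine hf ?_
        simpa only [hD, id_eq] using h0 f) hε
    exact ⟨f, fun x => by simpa only [hD] using hf x⟩

omit [CompleteSpace H] in
-- The zero extensions of `g` and of its restriction agree on the open set `interior A`, the only
-- place where derivatives are compared.
theorem IsCq.isCqClosure_restrict (hU : IsOpen U) {A : Set (EuclideanSpace ℝ (Fin m))}
    (hA : A ⊆ U) {g : U → H} (hg : IsCq q g) :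
    IsCqClosure hA fun (α : MultiIndex m q) x => dAlpha α.1 g (Set.inclusion hA x) := by
  have e : Set.EqOn (extendZero g)
      (extendZero fun x : A => dAlpha (zeroIndex m q).1 g (Set.inclusion hA x)) (interior A) := by
    intro x hx
    have h1 := extendZero_apply g ⟨x, hA (interior_subset hx)⟩
    have h2 := extendZero_apply (fun x : A => dAlpha (zeroIndex m q).1 g (Set.inclusion hA x))
      ⟨x, interior_subset hx⟩
    rw [dAlpha_zeroIndex] at h2 ⊢
    exact h1.trans h2.symm
  refine ⟨⟨fun α => (hg.continuous_dAlpha hU α).comp (continuous_inclusion hA),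
    (hg.mono (interior_subset.trans hA)).congr fun x hx => (e hx).symm, fun α x hx =>
    eqOn_iterPartial isOpen_interior e α.1 hx⟩, fun ε hε => ⟨g, hg, fun x => by simpa using hε⟩⟩

theorem isCqUniversal_iff (hU : IsOpen U) (hK : IsPositiveDefiniteKernel K)
    (hE : ∀ f : KernelSpace K hK, IsCq q (f : U → H)) :
    IsCqUniversal q K hK ↔
      ∀ (A : Set (EuclideanSpace ℝ (Fin m))) (hA : A ⊆ U), IsCompact A →
        closure (interior A) = A →
        ∀ η : MultiIndex m q → VectorMeasure A H, (∀ α, IsRadon (η α)) →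
        (∃ G : MultiIndex m q → A → H, IsCqClosure hA G ∧
          ∑ α, bartleIntegral (G α) (η α) ≠ 0) →
        ∃ k : KernelSpace K hK, IsPotential K hK (Set.inclusion hA) η k ∧ 0 < inner ℂ k k := by
  have hb : ∀ {A : Set (EuclideanSpace ℝ (Fin m))}, IsCompact A → ∀ {F : A → H},
      Continuous F → ∃ C, ∀ z, ‖F z‖ ≤ C := fun hA F hF => by
    have := isCompact_iff_compactSpace.1 hA
    obtain ⟨C, hC⟩ := isCompact_univ.exists_bound_of_continuousOn hF.continuousOn
    exact ⟨C, fun z => hC z trivial⟩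
  have hi : ∀ {A : Set (EuclideanSpace ℝ (Fin m))}, IsCompact A → ∀ {F : A → H},
      Continuous F → ∀ (μ : Measure A) [IsFiniteMeasure μ], Integrable F μ :=
    fun hA F hF μ _ => by
      obtain ⟨C, hC⟩ := hb hA hF
      exact integrable_of_bounded hF.stronglyMeasurable hC
  have hc : ∀ {A : Set (EuclideanSpace ℝ (Fin m))} (hA : A ⊆ U) {F : U → H}, IsCq q F →
      ∀ α : MultiIndex m q, Continuous fun z => dAlpha α.1 F (Set.inclusion hA z) :=
    fun hA F hF α => (hF.continuous_dAlpha hU α).comp (continuous_inclusion hA)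
  have pos := fun (A : Set (EuclideanSpace ℝ (Fin m))) (hA : A ⊆ U) (hAc : IsCompact A)
      (η : MultiIndex m q → VectorMeasure A H) (hη : ∀ α, IsRadon (η α)) =>
    exists_isPotential_pos_iff (η := η) (ι := Set.inclusion hA) hU hK hE (continuous_inclusion hA)
      (fun α f => hb hAc (hc hA (hE f) α)) fun α => (hη α).1
  constructor
  · rintro ⟨-, h⟩ A hA hAc - η hη ⟨G, hG, hne⟩
    rw [pos A hA hAc η hη]
    by_contra! h0
    have hfin : ∀ α, IsFiniteMeasure (η α).variation := fun α => (hη α).1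
    refine hne (sum_bartleIntegral_eq_zero_of_approx hfin
      (F := fun α (f : KernelSpace K hK) z => dAlpha α.1 f (Set.inclusion hA z)) (G := G)
      (fun α f => hi hAc (hc hA (hE f) α) _) (fun α => hi hAc (hG.1.1 α) _) h0 fun ε hε => ?_)
    -- `G` is only a limit of restrictions, so half of `ε` is spent on reaching a function defined
    -- on `U`.
    obtain ⟨g, hg, hgG⟩ := hG.2 (ε / 2) (half_pos hε)
    obtain ⟨f, hf⟩ := h (Subtype.val ⁻¹' A)
      (Topology.IsInducing.subtypeVal.isCompact_preimage_iff (by simpa using hA) |>.2 hAc)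
      g hg (ε / 2) (half_pos hε)
    refine ⟨f, fun z => ?_⟩
    calc ∑ α : MultiIndex m q, ‖dAlpha α.1 f (Set.inclusion hA z) - G α z‖
        ≤ ∑ α : MultiIndex m q,
            (‖dAlpha α.1 f (Set.inclusion hA z) - dAlpha α.1 g (Set.inclusion hA z)‖ +
              ‖dAlpha α.1 g (Set.inclusion hA z) - G α z‖) :=
          Finset.sum_le_sum fun α _ => norm_sub_le_norm_sub_add_norm_sub _ _ _
      _ < ε / 2 + ε / 2 := by
          rw [Finset.sum_add_distrib]
          exact add_lt_add (hf (Set.inclusion hA z) z.2) (hgG z)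
      _ = ε := add_halves ε
  · refine fun h => ⟨hE, fun A hA g hg ε hε => ?_⟩
    -- The given compact set need not be the closure of its interior. It is enlarged to `B = closure
    -- (interior L)`, which is, and which still lies in `U`.
    obtain ⟨L, hL, hAL, hLU⟩ := exists_compact_between (hA.image continuous_subtype_val) hU
      (by rintro _ ⟨x, -, rfl⟩; exact x.2)
    set B := closure (interior L)
    have hBL : B ⊆ L := closure_minimal interior_subset hL.isClosed
    have hB : IsCompact B := hL.of_isClosed_subset isClosed_closure hBL
    have hBU : B ⊆ U := hBL.trans hLU
    have := isCompact_iff_compactSpace.1 hB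
    obtain ⟨D, hD⟩ := exists_clm_dAlpha_kernelSpace hU hK hE
    obtain ⟨f, hf⟩ := exists_approx_of_annihilators (fun α (z : B) => D α (Set.inclusion hBU z))
      (fun α f => by simp only [hD]; exact hc hBU (hE f) α)
      -- On the compact set `B`, vanishing at infinity is no condition.
      (fun α f => by simp) (fun α z => dAlpha α.1 g (Set.inclusion hBU z))
      (fun α => hc hBU hg α) (fun α => by simp) (fun η hη h0 => by
        by_contra hne
        obtain ⟨f, hf⟩ := (pos B hBU hB η hη).1
          (h B hBU hB closure_interior_idem η hη ⟨_, hg.isCqClosure_restrict hU hBU, hne⟩)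
        refine hf ?_
        simpa only [hD] using h0 f) hε
    refine ⟨f, fun x hx => ?_⟩
    simpa only [hD] using hf ⟨x.1, subset_closure (hAL ⟨x, hx, rfl⟩)⟩

end Universality

theorem mainTheorem4 {H : Type*} [NormedAddCommGroup H] [InnerProductSpace ℂ H] [CompleteSpace H]
    [TopologicalSpace.SeparableSpace H] (m q : ℕ) (U : Set (EuclideanSpace ℝ (Fin m)))
    (hU : IsOpen U) (K : U → U → H →L[ℂ] H) (hK : IsPositiveDefiniteKernel K) :
    -- the case of `C^q_0(U, H)`
    ((∀ F : KernelSpace K hK, IsC0q q (F : U → H)) →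
      HasKernelDerivatives q K (IsC0q q) ∧
      (∀ η : MultiIndex m q → VectorMeasure U H, (∀ α, IsRadon (η α)) →
        ∃ k : KernelSpace K hK, IsPotential K hK id η k ∧ DerivativeFormula K id η ∧
          DoubleIntegralFormula K id η (inner ℂ k k) ∧ DensityFormula K id η (inner ℂ k k)) ∧
      (IsC0qUniversal q K hK ↔
        ∀ η : MultiIndex m q → VectorMeasure U H, (∀ α, IsRadon (η α)) →
          (∃ F : U → H, IsC0q q F ∧ ∑ α, bartleIntegral (dAlpha α.1 F) (η α) ≠ 0) →
          ∃ k : KernelSpace K hK, IsPotential K hK id η k ∧ 0 < inner ℂ k k)) ∧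
    -- the case of `C^q(U, H)`
    ((∀ F : KernelSpace K hK, IsCq q (F : U → H)) →
      HasKernelDerivatives q K (IsCq q) ∧
      (∀ (A : Set (EuclideanSpace ℝ (Fin m))) (hA : A ⊆ U), IsCompact A →
        closure (interior A) = A →
        ∀ η : MultiIndex m q → VectorMeasure A H, (∀ α, IsRadon (η α)) →
        ∃ k : KernelSpace K hK, IsPotential K hK (Set.inclusion hA) η k ∧
          DerivativeFormula K (Set.inclusion hA) η ∧
          DoubleIntegralFormula K (Set.inclusion hA) η (inner ℂ k k) ∧
          DensityFormula K (Set.inclusion hA) η (inner ℂ k k)) ∧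
      (IsCqUniversal q K hK ↔
        ∀ (A : Set (EuclideanSpace ℝ (Fin m))) (hA : A ⊆ U), IsCompact A →
          closure (interior A) = A →
          ∀ η : MultiIndex m q → VectorMeasure A H, (∀ α, IsRadon (η α)) →
          (∃ G : MultiIndex m q → A → H, IsCqClosure hA G ∧
            ∑ α, bartleIntegral (G α) (η α) ≠ 0) →
          ∃ k : KernelSpace K hK, IsPotential K hK (Set.inclusion hA) η k ∧
            0 < inner ℂ k k)) := by
  refine ⟨fun hE => ?_, fun hE => ?_⟩
  · have hE' := fun f => (hE f).1
    refine ⟨kernelSpace_hasKernelDerivatives hU hK hE' hE, fun η hη => ?_,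
      isC0qUniversal_iff hU hK hE⟩
    obtain ⟨k, -, hk⟩ := exists_isPotential (η := η) (ι := id) hU hK hE' continuous_id
      (fun α f => exists_bound_of_tendsto_cocompact ((hE f).2 α).1 ((hE f).2 α).2)
      fun α => (hη α).1
    exact ⟨k, hk⟩
  · refine ⟨kernelSpace_hasKernelDerivatives hU hK hE hE, fun A hA hAc _ η hη => ?_,
      isCqUniversal_iff hU hK hE⟩
    have := isCompact_iff_compactSpace.1 hAc
    obtain ⟨k, -, hk⟩ := exists_isPotential (η := η) (ι := Set.inclusion hA) hU hK hE
      (continuous_inclusion hA) (fun α f => exists_bound_of_tendsto_cocompact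
        (((hE f).continuous_dAlpha hU α).comp (continuous_inclusion hA)) (by simp))
      fun α => (hη α).1
    exact ⟨k, hk⟩
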